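/- **Setting.** Let $1\le s\le p$ and $n\ge 1$ be integers, $\sigma>0$, $R>0$, $\lambda=\sigma^2/n$, $\nu=2\lambda$, and let $Y_i=\theta_i+\varepsilon_i$, $i\le p$, with $\varepsilon_i$ i.i.d. $N(0,\lambda)$. Let $$\Theta_\downarrow(s,R)=\{\theta\in\mathbb R^p:\ \exists k\le s,\ \theta_1^2\ge\dots\ge\theta_k^2\ge 0,\ \theta_1^2\le R,\ \theta_i=0 \text{ for } i>k\},\qquad V_i=\theta_i^2 .$$ **Estimator.** Let $Z_i\sim N(0,\lambda)$ and $Z'_i\sim N(0,\nu)$ be independent of each other and of $Y$ (all coordinates independent), put $Y^{(\pm)}=Y\pm Z$ and, for a normalisation $a\in\{1,\sqrt2\}$, $$X^{(1)}_i=\Big(\frac{Y_i^{(+)}+Z'_i}{a}\Big)^2-\frac{2\nu}{a^2},\qquad X^{(2)}_i=\Big(\frac{Y_i^{(+)}-Z'_i}{a}\Big)^2-\frac{2\nu}{a^2}.$$ Let $\widetilde V$ minimise $\sum_i (X_i^{(1)}-v_i)^2$ over $v_1\ge\dots\ge v_p\ge0$, and let $\widetilde V_i^{\cap}=\min\{\widetilde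 V_i,R\}$. With $t_m=2^m\nu$ and $M=1+\lceil\log_2(1+R/\nu)\rceil$, let $I_m=\{i: t_m\le \widetilde V_i^{\cap}+\nu<t_{m+1}\}$ for $0\le m<M$. Let $\widehat V^{\mathrm{raw}}$ minimise $\sum_{m<M}\sum_{i\in I_m}t_m^{-1}(X_i^{(2)}-v_i)^2$ over $v_1\ge\dots\ge v_p\ge0$, let $\widehat V_i=\min\{\widehat V_i^{\mathrm{raw}},R\}$, and $$\widehat\theta_i=\frac{\widehat V_i}{\widehat V_i+\nu}\,Y_i^{(-)} .$$ Let (B1) be the event that $t_m\le V_i+\nu<t_{m+1}$ for all $0\le m<M$ and all $i\in I_m$. **Theorem 4.1.** 1. The event (B1) has positive probability for every $\theta\in\Theta_\downarrow(s,R)$, and there is a universal constant $C>0$ such that, if $\sigma^2/n\le R$, $$\sup_{\theta\in\Theta_\downarrow(s,R)}\mathbb E_\theta\big[\|\widehat\theta-\theta\|_2^2\,\big|\,(\mathrm{B1})\big]\le C\,s\frac{\sigma^2}{n}\log\Big(\frac{ep}{s}\Big)\log\Big(1+\frac{Rn}{\sigma^2}\Big),$$ while if $R\le\sigma^2/n$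 the same supremum is at most $C\,s\frac{\sigma^2}{n}\log(ep/s)$. 2. There is a universal constant $c>0$ such that, whenever $\sigma^2/n\le R$, $$\inf_{\tilde\theta}\sup_{\theta\in\Theta_\downarrow(s,R)}\mathbb E_\theta\|\tilde\theta-\theta\|_2^2\ge c\,s\frac{\sigma^2}{n},$$ the infimum being over all (possibly randomized) estimators based on $Y$. 3. For $\kappa\in(0,1/4)$ say that $\theta$ satisfies the dyadic-margin condition if for every $i\le p$, with $m\ge0$ the index such that $t_m\le V_i+\nu<t_{m+1}$, one has $V_i+\nu\le t_{m+1}(1-\kappa)$ and, when $m\ge1$, also $t_m(1+\kappa)\le V_i+\nu$. For every $c_0>0$ there is $C'>0$, depending only on $c_0$, such that whenever $\kappa\in(0,1/4)$ and $\kappa^2\nu/(R+\nu)\ge c_0\log p$, $$\sup_{\theta}\mathbb E_\theta\|\widehat\theta-\theta\|_2^2\le C'\,s\frac{\sigma^2}{n}\log\Big(\frac{ep}{s}\Big)\log\Big(1+\frac{Rn}{\sigma^2}\Big)+C'\Big(sR+\frac{p\sigma^2}{n}\Big)p^{-3/2},$$ the supremum being over all $\theta\in\Theta_\downarrow(s,R)$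 that satisfy the dyadic-margin condition. -/

import Mathlib

open MeasureTheory ProbabilityTheory
open scoped ENNReal NNReal

namespace IsoEB

noncomputable section

/-! Sparse ordered signals and the Gaussian sequence model. -/

/-- The sparse ordered class `Θ↓(s,R)`. Coordinates are indexed by `0, …, p-1`, so the coordinates
`1, …, k` of the usual numbering are the `i : Fin p` with `(i : ℕ) < k`. -/
def sparseClass (p s : ℕ) (R : ℝ) : Set (Fin p → ℝ) :=
  {θ | ∃ k : ℕ, k ≤ s ∧
    (∀ i j : Fin p, i ≤ j → (j : ℕ) < k → θ j ^ 2 ≤ θ i ^ 2) ∧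
    (∀ i : Fin p, (i : ℕ) = 0 → θ i ^ 2 ≤ R) ∧
    (∀ i : Fin p, k ≤ (i : ℕ) → θ i = 0)}

/-- The law of a vector with independent coordinates `N(θ_i, v)`. -/
def gaussVec {p : ℕ} (θ : Fin p → ℝ) (v : ℝ) : Measure (Fin p → ℝ) :=
  Measure.pi fun i => gaussianReal (θ i) v.toNNReal

/-- Squared Euclidean loss, as an extended nonnegative real. -/
def sqLoss {p : ℕ} (u θ : Fin p → ℝ) : ℝ≥0∞ :=
  ENNReal.ofReal (∑ i, (u i - θ i) ^ 2)

/-! Weighted isotonic least squares. -/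

/-- Nonincreasing nonnegative sequences. -/
def isoCone (p : ℕ) : Set (Fin p → ℝ) := {v | Antitone v ∧ ∀ i, 0 ≤ v i}

/-- The weighted least squares criterion. -/
def isoLoss {p : ℕ} (w x v : Fin p → ℝ) : ℝ := ∑ i, w i * (x i - v i) ^ 2

/-- `v` minimises the weighted criterion over nonincreasing nonnegative sequences. -/
def IsIsoFit {p : ℕ} (w x v : Fin p → ℝ) : Prop :=
  v ∈ isoCone p ∧ ∀ u ∈ isoCone p, isoLoss w x v ≤ isoLoss w x u

theorem exists_isIsoFit {p : ℕ} (w x : Fin p → ℝ) (hw : ∀ i, 0 < w i) :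
    ∃ v, IsIsoFit w x v := by
  have hcont : Continuous (isoLoss w x) := by unfold isoLoss; fun_prop
  set L := isoLoss w x 0 with hL
  have hL0 : 0 ≤ L := Finset.sum_nonneg fun i _ => mul_nonneg (hw i).le (sq_nonneg _)
  have hzero : (0 : Fin p → ℝ) ∈ isoCone p := ⟨fun _ _ _ => le_rfl, fun _ => le_rfl⟩
  have hclosed : IsClosed (isoCone p) := by
    have h1 : isoCone p = (⋂ i, ⋂ j, ⋂ _ : i ≤ j, {v : Fin p → ℝ | v j ≤ v i}) ∩
        ⋂ i, {v : Fin p → ℝ | 0 ≤ v i} := by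
      ext v
      simp [isoCone, Antitone]
    rw [h1]
    refine IsClosed.inter ?_ ?_
    · exact isClosed_iInter fun i => isClosed_iInter fun j => isClosed_iInter fun _ =>
        isClosed_le (continuous_apply j) (continuous_apply i)
    · exact isClosed_iInter fun i => isClosed_le continuous_const (continuous_apply i)
  have hK : IsCompact (isoCone p ∩ Set.pi Set.univ
      (fun i => Set.Icc (0 : ℝ) (|x i| + Real.sqrt (L / w i)))) :=
    (isCompact_univ_pi fun i => isCompact_Icc).inter_left hclosed
  have h0K : (0 : Fin p → ℝ) ∈ isoCone p ∩ Set.pi Set.univ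
      (fun i => Set.Icc (0 : ℝ) (|x i| + Real.sqrt (L / w i))) :=
    ⟨hzero, fun i _ => ⟨le_rfl, by simp only [Pi.zero_apply]; positivity⟩⟩
  obtain ⟨v, hv, hmin⟩ := hK.exists_isMinOn ⟨0, h0K⟩ hcont.continuousOn
  refine ⟨v, hv.1, fun u hu => ?_⟩
  by_cases h : isoLoss w x u ≤ L
  · refine hmin ⟨hu, fun i _ => ⟨hu.2 i, ?_⟩⟩
    have h1 : w i * (x i - u i) ^ 2 ≤ L :=
      (Finset.single_le_sum (f := fun i => w i * (x i - u i) ^ 2)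
        (fun j _ => mul_nonneg (hw j).le (sq_nonneg _)) (Finset.mem_univ i)).trans h
    have h2 : (x i - u i) ^ 2 ≤ L / w i := by
      rw [le_div_iff₀ (hw i)]; linarith
    have h3 := Real.abs_le_sqrt h2
    have h4 := neg_abs_le (x i - u i)
    have h5 := le_abs_self (x i)
    linarith
  · exact (hmin h0K).trans (not_le.mp h).le

theorem IsIsoFit.unique {p : ℕ} {w x u v : Fin p → ℝ} (hw : ∀ i, 0 < w i)
    (hu : IsIsoFit w x u) (hv : IsIsoFit w x v) : u = v := by
  have hm : (fun i => (u i + v i) / 2) ∈ isoCone p := by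
    refine ⟨fun i j hij => ?_, fun i => ?_⟩
    · have h1 := hu.1.1 hij
      have h2 := hv.1.1 hij
      dsimp only
      linarith
    · have h1 := hu.1.2 i
      have h2 := hv.1.2 i
      dsimp only
      linarith
  have h1 := hu.2 _ hm
  have h2 := hv.2 _ hm
  have key : isoLoss w x u + isoLoss w x v =
      2 * isoLoss w x (fun i => (u i + v i) / 2) + ∑ i, w i * ((u i - v i) ^ 2 / 2) := by
    unfold isoLoss
    rw [Finset.mul_sum, ← Finset.sum_add_distrib, ← Finset.sum_add_distrib]
    exact Finset.sum_congr rfl fun i _ => by ring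
  have h3 : ∑ i, w i * ((u i - v i) ^ 2 / 2) ≤ 0 := by linarith
  have hnn : ∀ i ∈ Finset.univ, 0 ≤ w i * ((u i - v i) ^ 2 / 2) := fun i _ =>
    mul_nonneg (hw i).le (by positivity)
  have h4 := (Finset.sum_eq_zero_iff_of_nonneg hnn).mp (le_antisymm h3 (Finset.sum_nonneg hnn))
  funext i
  have h5 := h4 i (Finset.mem_univ i)
  have h6 : (u i - v i) ^ 2 = 0 := by
    rcases mul_eq_zero.mp h5 with h | h
    · exact absurd h (hw i).ne'
    · linarith
  have h7 := pow_eq_zero_iff (two_ne_zero) |>.mp h6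
  linarith

/-- The weighted isotonic least squares fit. For positive weights it is the minimiser, which exists
and is unique by `exists_isIsoFit` and `IsIsoFit.unique`. -/
def isoFit {p : ℕ} (w x : Fin p → ℝ) : Fin p → ℝ := Classical.epsilon (IsIsoFit w x)

theorem isIsoFit_isoFit {p : ℕ} (w x : Fin p → ℝ) (hw : ∀ i, 0 < w i) :
    IsIsoFit w x (isoFit w x) :=
  Classical.epsilon_spec (exists_isIsoFit w x hw)

/-! Dyadic bins. -/

/-- The dyadic threshold `t_m = 2^m ν`. -/
def thr (ν : ℝ) (m : ℕ) : ℝ := 2 ^ m * ν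

/-- The number of bins, `M = 1 + ⌈log₂ (1 + R/ν)⌉`. -/
def numBins (R ν : ℝ) : ℕ := 1 + ⌈Real.logb 2 (1 + R / ν)⌉₊

/-- The index block `I_m` determined by a (capped) pilot profile `u`. -/
def bin {p : ℕ} (ν : ℝ) (u : Fin p → ℝ) (m : ℕ) : Set (Fin p) :=
  {i | thr ν m ≤ u i + ν ∧ u i + ν < thr ν (m + 1)}

open Classical in
/-- The weight `1 / t_m` for `i ∈ I_m`, `0 ≤ m < M`. -/
def binWeight {p : ℕ} (R ν : ℝ) (u : Fin p → ℝ) (i : Fin p) : ℝ :=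
  ∑ m ∈ Finset.range (numBins R ν), if i ∈ bin ν u m then 1 / thr ν m else 0

/-- The bins cover every coordinate of a profile with values in `[0, R]`, so all weights are
positive. -/
theorem binWeight_pos {p : ℕ} {R ν : ℝ} (hν : 0 < ν) {u : Fin p → ℝ}
    (hu0 : ∀ i, 0 ≤ u i) (huR : ∀ i, u i ≤ R) (i : Fin p) : 0 < binWeight R ν u i := by
  have hR : 0 ≤ R := (hu0 i).trans (huR i)
  have hx : 1 ≤ 1 + u i / ν := by have := div_nonneg (hu0 i) hν.le; linarith
  obtain ⟨m, hm1, hm2⟩ := exists_nat_pow_near hx (one_lt_two)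
  have hmul : (1 + u i / ν) * ν = u i + ν := by field_simp; ring
  have hmem : i ∈ bin ν u m := by
    refine ⟨?_, ?_⟩
    · rw [← hmul]; exact mul_le_mul_of_nonneg_right hm1 hν.le
    · rw [← hmul]; exact mul_lt_mul_of_pos_right hm2 hν
  have hmM : m < numBins R ν := by
    have hle : (2 : ℝ) ^ m ≤ 1 + R / ν := hm1.trans (by
      have := div_le_div_of_nonneg_right (huR i) hν.le; linarith)
    have hlog : (m : ℝ) ≤ Real.logb 2 (1 + R / ν) := by
      rw [Real.le_logb_iff_rpow_le one_lt_two (by positivity), Real.rpow_natCast]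
      exact hle
    have h2 : (m : ℝ) ≤ (⌈Real.logb 2 (1 + R / ν)⌉₊ : ℝ) := hlog.trans (Nat.le_ceil _)
    have h3 : m ≤ ⌈Real.logb 2 (1 + R / ν)⌉₊ := by exact_mod_cast h2
    unfold numBins
    omega
  unfold binWeight
  refine Finset.sum_pos' (fun k _ => ?_) ⟨m, Finset.mem_range.mpr hmM, ?_⟩
  · split_ifs
    · unfold thr; positivity
    · exact le_rfl
  · rw [if_pos hmem]; unfold thr; positivity

/-! The randomized cross-fit estimator. Its input is the observation `y`, the cloning noise `z` and
the noise `z'` of the second split; `ν` is the variance of each clone `y ± z`, and `a` normalises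
the second split: the two folds are `(y⁺ + z') / a` and `(y⁺ - z') / a`, with coordinates of
variance `2 ν / a²`. -/

/-- The variance proxies of the two folds (`e = 1` for the pilot fold, `e = -1` for the other). -/
def proxy {p : ℕ} (a ν e : ℝ) (yp z' : Fin p → ℝ) (i : Fin p) : ℝ :=
  ((yp i + e * z' i) / a) ^ 2 - 2 * ν / a ^ 2

/-- The capped pilot profile: unweighted isotonic fit on the first fold, truncated at `R`. -/
def pilot {p : ℕ} (a R ν : ℝ) (yp z' : Fin p → ℝ) (i : Fin p) : ℝ :=
  min (isoFit (fun _ => 1) (proxy a ν 1 yp z') i) R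

/-- The variance profile: isotonic fit on the second fold, with the weights from the pilot bins,
truncated at `R`. -/
def Vhat {p : ℕ} (a R ν : ℝ) (yp z' : Fin p → ℝ) (i : Fin p) : ℝ :=
  min (isoFit (binWeight R ν (pilot a R ν yp z')) (proxy a ν (-1) yp z') i) R

/-- The shrinkage estimator: profile from the clone `y + z`, shrinkage of the clone `y - z`. -/
def thetaHat {p : ℕ} (a R ν : ℝ) (y z z' : Fin p → ℝ) (i : Fin p) : ℝ :=
  Vhat a R ν (y + z) z' i / (Vhat a R ν (y + z) z' i + ν) * (y i - z i)

/-- The joint law of `(Y, Z, Z')`: independent, `Y_i ~ N(θ_i, lam)`, `Z_i ~ N(0, lam)` and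
`Z'_i ~ N(0, 2 lam)`. -/
def jointLaw {p : ℕ} (lam : ℝ) (θ : Fin p → ℝ) :
    Measure ((Fin p → ℝ) × (Fin p → ℝ) × (Fin p → ℝ)) :=
  (gaussVec θ lam).prod ((gaussVec 0 lam).prod (gaussVec 0 (2 * lam)))

/-- The binning event: every pilot bin lies on the dyadic scale of the true `θ_i² + ν`. -/
def eventB1 {p : ℕ} (a R ν : ℝ) (θ : Fin p → ℝ) :
    Set ((Fin p → ℝ) × (Fin p → ℝ) × (Fin p → ℝ)) :=
  {ω | ∀ m < numBins R ν, ∀ i ∈ bin ν (pilot a R ν (ω.1 + ω.2.1) ω.2.2) m,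
    thr ν m ≤ θ i ^ 2 + ν ∧ θ i ^ 2 + ν < thr ν (m + 1)}

/-- The risk of the estimator with `ν = 2 lam` when the data are drawn from `P`. -/
def riskUnder {p : ℕ} (a R lam : ℝ) (θ : Fin p → ℝ)
    (P : Measure ((Fin p → ℝ) × (Fin p → ℝ) × (Fin p → ℝ))) : ℝ≥0∞ :=
  ∫⁻ ω, sqLoss (thetaHat a R (2 * lam) ω.1 ω.2.1 ω.2.2) θ ∂P

/-- The unconditional risk. -/
def risk {p : ℕ} (a R lam : ℝ) (θ : Fin p → ℝ) : ℝ≥0∞ :=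
  riskUnder a R lam θ (jointLaw lam θ)

/-- The risk conditional on the binning event. -/
def condRisk {p : ℕ} (a R lam : ℝ) (θ : Fin p → ℝ) : ℝ≥0∞ :=
  riskUnder a R lam θ (ProbabilityTheory.cond (jointLaw lam θ) (eventB1 a R (2 * lam) θ))

/-- The dyadic margin condition with parameter `κ`. The lower margin is required only above the
smallest threshold `t_0 = ν`, since `ν ≤ θ_i² + ν` always holds. -/
def DyadicMargin {p : ℕ} (κ ν : ℝ) (θ : Fin p → ℝ) : Prop :=
  ∀ i : Fin p, ∀ m : ℕ, thr ν m ≤ θ i ^ 2 + ν → θ i ^ 2 + ν < thr ν (m + 1) →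
    (1 ≤ m → thr ν m * (1 + κ) ≤ θ i ^ 2 + ν) ∧ θ i ^ 2 + ν ≤ thr ν (m + 1) * (1 - κ)

/-- The minimax risk over the class, for possibly randomized estimators: a Markov kernel `δ` gives
the law `δ y` of the estimate when `y` is observed. -/
def minimaxRisk (p s : ℕ) (R lam : ℝ) : ℝ≥0∞ :=
  ⨅ (δ : Kernel (Fin p → ℝ) (Fin p → ℝ)) (_ : IsMarkovKernel δ), ⨆ θ ∈ sparseClass p s R,
    ∫⁻ y, ∫⁻ u, sqLoss u θ ∂(δ y) ∂(gaussVec θ lam)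

end

end IsoEB

/-!
Estimation of sparse ordered signals by cross-fitted isotonic shrinkage.

*Conditional upper bound.* The pilot fold `Y + Z + Z'`, the second fold `Y + Z - Z'` and the clone
`Y - Z` are independent (`measurePreserving_folds`). The binning event depends on the pilot fold
only, and on it every pilot bin is the true one, so the weights of the second isotonic fit are the
deterministic weights of the true profile. The conditional risk is therefore at most the risk of the
estimator with oracle weights (`condRisk_le_oracleRisk`). For shrinkage by `v / (v + ν)` the excess
risk is a weighted squared error of `v`, with weights of the order `1 / (θ_i² + ν)`, which is what
the weighted isotonic fit minimises. With the normalisation `a = √2` the fit estimates `θ² / 2`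
instead of `θ²`, at the price of a factor `2`.

The error of the isotonic fit is bounded by first order optimality (`sum_sq_sub_le_avgSup`): on the
`k ≤ s` support coordinates by the noise, and on the remaining coordinates, where the target is zero
and the weights are equal, by the envelope `max_{l ≥ j} (S_l / l)⁺` of the averages of the noise.
Only second moments of the noise matter: by a pathwise version of Doob's inequality
(`sq_runMax_le`) and Kronecker's lemma the squared envelope at `j` has expectation of order `ν² / j`
(`exists_majorant_sq_avgSup`), and the harmonic sum gives `ν (k + log (e p))`, which is at most a
multiple of `ν s log (e p / s)`. This is stronger than required when `lam ≤ R`, since the factor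
`log (1 + R / lam)` is then bounded below. The binning event has positive probability because it
contains a nonempty open set of data (`measure_eventB1_ne_zero`).

*Lower bound.* Assouad's lemma on the hypercube `{±√lam}^s`, which lies in the class since only the
squares of the coordinates are ordered (`le_minimaxRisk`).

*Unconditional upper bound.* As `κ < 1/4`, the quantity `κ² ν / (R + ν)` is below `1/16`, so the
hypothesis `κ² ν / (R + ν) ≥ c₀ log p` bounds `p` in terms of `c₀`. Hence `p ^ (-3/2)` is bounded
below, and the crude bound `4 (s R + p lam)`, valid for shrinkage by any factors in `[0, 1]`
(`risk_le`), is absorbed by the second term.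
-/

namespace IsoEB

/-! ### Partial sums, running maxima and maximal averages -/

/-- Extension of a finite sequence by zero. -/
def zeroExt {n : ℕ} (e : Fin n → ℝ) (i : ℕ) : ℝ := if h : i < n then e ⟨i, h⟩ else 0

theorem zeroExt_val {n : ℕ} (e : Fin n → ℝ) (i : Fin n) : zeroExt e i = e i := by
  simp [zeroExt]

/-- The weighted partial sum `∑_{i < l} c_i e_i`. -/
def partialSum (c e : ℕ → ℝ) (l : ℕ) : ℝ := ∑ i ∈ Finset.range l, c i * e i

theorem partialSum_succ (c e : ℕ → ℝ) (l : ℕ) :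
    partialSum c e (l + 1) = partialSum c e l + c l * e l := Finset.sum_range_succ _ _

/-- The running maximum `max (U 0) … (U n)`. -/
def runMax (U : ℕ → ℝ) : ℕ → ℝ
  | 0 => U 0
  | n + 1 => max (runMax U n) (U (n + 1))

theorem le_runMax (U : ℕ → ℝ) {i n : ℕ} (h : i ≤ n) : U i ≤ runMax U n := by
  induction n with
  | zero => obtain rfl : i = 0 := by omega
            exact le_rfl
  | succ n ih =>
    rcases Nat.lt_or_ge n i with h' | h'
    · obtain rfl : i = n + 1 := by omega
      exact le_max_right _ _
    · exact (ih h').trans (le_max_left _ _)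

theorem runMax_congr {U V : ℕ → ℝ} {n : ℕ} (h : ∀ i ≤ n, U i = V i) :
    runMax U n = runMax V n := by
  induction n with
  | zero => exact h 0 le_rfl
  | succ n ih =>
    simp only [runMax]
    rw [ih fun i hi => h i (by omega), h (n + 1) le_rfl]

/-- Pathwise form of Doob's `L²` maximal inequality: for a martingale `U` the last sum is a
martingale transform, hence has mean zero. -/
theorem sq_runMax_le {U : ℕ → ℝ} (h0 : U 0 = 0) (n : ℕ) :
    runMax U n ^ 2 ≤
      4 * U n ^ 2 - 4 * ∑ i ∈ Finset.range n, runMax U i * (U (i + 1) - U i) := by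
  have key : runMax U n ^ 2 ≤ 2 * runMax U n * U n
      - 2 * ∑ i ∈ Finset.range n, runMax U i * (U (i + 1) - U i) := by
    induction n with
    | zero => simp [runMax, h0]
    | succ n ih =>
      rw [Finset.sum_range_succ]
      simp only [runMax]
      rcases le_total (runMax U n) (U (n + 1)) with h | h
      · rw [max_eq_right h]
        nlinarith [sq_nonneg (U (n + 1) - runMax U n)]
      · rw [max_eq_left h]
        linarith
  nlinarith [sq_nonneg (runMax U n - 2 * U n)]

/-- Abel summation in the style of Kronecker's lemma: weighted averages of `e` are controlled by
the partial sums of the series `∑ c_i e_i`. -/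
theorem mul_sum_le_partialSum {c e : ℕ → ℝ} (hc : ∀ i, 0 < c i) (hanti : Antitone c) {B : ℝ}
    (l : ℕ) (hB : ∀ i ≤ l + 1, -partialSum c e i ≤ B) :
    c l * ∑ i ∈ Finset.range (l + 1), e i ≤ partialSum c e (l + 1) + B := by
  induction l with
  | zero =>
    have := hB 0 (by omega)
    simp [partialSum] at this ⊢
    exact this
  | succ l ih =>
    have h1 := ih fun i hi => hB i (by omega)
    have h2 := hB (l + 1) (by omega)
    rw [Finset.sum_range_succ, partialSum_succ, mul_add]
    have h3 : c (l + 1) ≤ c l := hanti (Nat.le_succ l)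
    set S := ∑ i ∈ Finset.range (l + 1), e i
    have h4 : c (l + 1) * S ≤ partialSum c e (l + 1) + B := by
      rcases le_total 0 S with hS | hS
      · exact (mul_le_mul_of_nonneg_right h3 hS).trans h1
      · have := mul_nonpos_of_nonneg_of_nonpos (hc (l + 1)).le hS
        linarith
    linarith

/-- The largest positive part of an average `(e_0 + ⋯ + e_l) / (l + 1)` over `j ≤ l < n`. -/
noncomputable def avgSup (n : ℕ) (e : ℕ → ℝ) (j : ℕ) : ℝ :=
  ((Finset.Ico j n).sup fun l => Real.toNNReal ((∑ i ∈ Finset.range (l + 1), e i) / (l + 1)) :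
    ℝ≥0)

theorem avgSup_nonneg (n : ℕ) (e : ℕ → ℝ) (j : ℕ) : 0 ≤ avgSup n e j := NNReal.coe_nonneg _

theorem avgSup_antitone (n : ℕ) (e : ℕ → ℝ) : Antitone (avgSup n e) := by
  intro i j hij
  unfold avgSup
  exact_mod_cast Finset.sup_mono (Finset.Ico_subset_Ico_left hij)

theorem sum_le_avgSup {n : ℕ} (e : ℕ → ℝ) {j : ℕ} (hj : j < n) :
    ∑ i ∈ Finset.range (j + 1), e i ≤ (j + 1) * avgSup n e j := by
  have h1 : (∑ i ∈ Finset.range (j + 1), e i) / (j + 1) ≤ avgSup n e j := by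
    refine (Real.le_coe_toNNReal _).trans ?_
    unfold avgSup
    exact_mod_cast Finset.le_sup
      (f := fun l : ℕ => Real.toNNReal ((∑ i ∈ Finset.range (l + 1), e i) / (l + 1)))
      (Finset.mem_Ico.mpr ⟨le_rfl, hj⟩)
  rw [div_le_iff₀ (by positivity)] at h1
  linarith

theorem avgSup_le {n : ℕ} {e : ℕ → ℝ} {j : ℕ} {A : ℝ} (hA : 0 ≤ A)
    (h : ∀ l, j ≤ l → l < n → (∑ i ∈ Finset.range (l + 1), e i) / (l + 1) ≤ A) :
    avgSup n e j ≤ A := by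
  lift A to ℝ≥0 using hA
  unfold avgSup
  norm_cast
  refine Finset.sup_le fun l hl => ?_
  rw [Finset.mem_Ico] at hl
  rw [Real.toNNReal_le_iff_le_coe]
  simpa using h l hl.1 hl.2

/-- Against a nonincreasing nonnegative `v` the sequence `e` acts at most like its envelope of
maximal averages. -/
theorem sum_mul_le_sum_avgSup_mul {n : ℕ} (e v : ℕ → ℝ)
    (hv : ∀ i, i + 1 < n → v (i + 1) ≤ v i) (hv0 : ∀ i < n, 0 ≤ v i) :
    ∑ i ∈ Finset.range n, e i * v i ≤ ∑ i ∈ Finset.range n, avgSup n e i * v i := by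
  have hD : ∀ j < n, ∑ i ∈ Finset.range (j + 1), (e i - avgSup n e i) ≤ 0 := by
    intro j hj
    rw [Finset.sum_sub_distrib]
    have h1 := sum_le_avgSup e hj
    have h2 : ((j : ℝ) + 1) * avgSup n e j ≤ ∑ i ∈ Finset.range (j + 1), avgSup n e i := by
      have := Finset.card_nsmul_le_sum (Finset.range (j + 1)) (avgSup n e) (avgSup n e j)
        fun i hi => avgSup_antitone n e (by rw [Finset.mem_range] at hi; omega)
      simpa using this
    linarith
  have key : ∀ j < n, ∑ i ∈ Finset.range (j + 1), (e i - avgSup n e i) * v i ≤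
      v j * ∑ i ∈ Finset.range (j + 1), (e i - avgSup n e i) := by
    intro j
    induction j with
    | zero => intro _; simp [mul_comm]
    | succ j ih =>
      intro hj
      rw [Finset.sum_range_succ, Finset.sum_range_succ _ (j + 1)]
      have h1 := ih (by omega)
      have h2 := hD j (by omega)
      have h3 := mul_le_mul_of_nonpos_right (hv j hj) h2
      linarith
  have h : ∑ i ∈ Finset.range n, (e i - avgSup n e i) * v i ≤ 0 := by
    rcases n with _ | n
    · simp
    · exact (key n (by omega)).trans
        (mul_nonpos_of_nonneg_of_nonpos (hv0 n (by omega)) (hD n (by omega)))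
  simp only [sub_mul, Finset.sum_sub_distrib] at h
  linarith

/-- The weights `1 / max (i + 1) (j + 1)`, constant up to `j` and harmonic from there on. -/
noncomputable def harmonicWeight (j i : ℕ) : ℝ := 1 / (max (i + 1) (j + 1) : ℕ)

theorem harmonicWeight_pos (j i : ℕ) : 0 < harmonicWeight j i := by
  unfold harmonicWeight
  have : 0 < max (i + 1) (j + 1) := by omega
  positivity

theorem harmonicWeight_antitone (j : ℕ) : Antitone (harmonicWeight j) := by
  intro a b hab
  unfold harmonicWeight
  have : 0 < max (a + 1) (j + 1) := by omega
  have h : max (a + 1) (j + 1) ≤ max (b + 1) (j + 1) := by omega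
  gcongr

theorem sum_sq_harmonicWeight_le (j n : ℕ) :
    ∑ i ∈ Finset.range n, harmonicWeight j i ^ 2 ≤ 2 / (j + 1) := by
  have hj : (0 : ℝ) < j + 1 := by positivity
  have h1 : ∀ n ≤ j + 1, ∑ i ∈ Finset.range n, harmonicWeight j i ^ 2 = n / ((j : ℝ) + 1) ^ 2 := by
    intro n hn
    have : ∀ i ∈ Finset.range n, harmonicWeight j i ^ 2 = 1 / ((j : ℝ) + 1) ^ 2 := by
      intro i hi
      rw [Finset.mem_range] at hi
      unfold harmonicWeight
      rw [max_eq_right (by omega)]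
      push_cast
      rw [div_pow, one_pow]
    rw [Finset.sum_congr rfl this]
    simp
    ring
  rcases le_total n (j + 1) with hn | hn
  · rw [h1 n hn, div_le_div_iff₀ (by positivity) hj]
    have : (n : ℝ) ≤ j + 1 := by exact_mod_cast hn
    nlinarith
  · have : ∑ i ∈ Finset.range n, harmonicWeight j i ^ 2 ≤ 2 / (j + 1) - 1 / n := by
      induction n, hn using Nat.le_induction with
      | base =>
        rw [h1 _ le_rfl]
        push_cast
        apply le_of_eq
        field_simp
        ring
      | succ m hm ih =>
        rw [Finset.sum_range_succ]
        have hm0 : (0 : ℝ) < m := by exact_mod_cast (by omega : 0 < m)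
        have h2 : harmonicWeight j m ^ 2 ≤ 1 / m - 1 / ((m + 1 : ℕ) : ℝ) := by
          unfold harmonicWeight
          rw [max_eq_left (by omega)]
          push_cast
          rw [div_sub_div _ _ hm0.ne' (by positivity), div_pow,
            div_le_div_iff₀ (by positivity) (by positivity)]
          nlinarith
        linarith
    have h3 : (0 : ℝ) ≤ 1 / n := by positivity
    linarith

/-- The maximal averages beyond `j` are controlled by the running maxima of the series
`∑ c_i e_i` with `c = harmonicWeight j` and of its negative. -/
theorem avgSup_le_runMax (n : ℕ) (e : ℕ → ℝ) (j : ℕ) :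
    avgSup n e j ≤ runMax (partialSum (harmonicWeight j) e) n +
      runMax (partialSum (harmonicWeight j) (fun i => -e i)) n := by
  have hneg : ∀ i, partialSum (harmonicWeight j) (fun i => -e i) i =
      -partialSum (harmonicWeight j) e i := by
    intro i
    simp [partialSum]
  have h0 : ∀ e' : ℕ → ℝ, 0 ≤ runMax (partialSum (harmonicWeight j) e') n := fun e' =>
    le_trans (by simp [partialSum]) (le_runMax _ (Nat.zero_le n))
  refine avgSup_le (add_nonneg (h0 _) (h0 _)) fun l hjl hln => ?_
  have h1 := mul_sum_le_partialSum (e := e) (harmonicWeight_pos j) (harmonicWeight_antitone j)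
    (B := runMax (partialSum (harmonicWeight j) (fun i => -e i)) n) l
    fun i hi => (hneg i).symm.le.trans (le_runMax _ (by omega))
  have h2 : partialSum (harmonicWeight j) e (l + 1) ≤ _ := le_runMax _ (by omega : l + 1 ≤ n)
  have h3 : harmonicWeight j l = 1 / ((l : ℝ) + 1) := by
    unfold harmonicWeight
    rw [max_eq_left (by omega)]
    push_cast
    rfl
  rw [h3] at h1
  rw [div_eq_mul_one_div, mul_comm]
  linarith

/-! ### A maximal inequality for averages of independent centred variables -/

theorem measurable_zeroExt {n : ℕ} (i : ℕ) : Measurable fun x : Fin n → ℝ => zeroExt x i := by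
  unfold zeroExt
  split_ifs <;> fun_prop

theorem measurable_partialSum {n : ℕ} (c : ℕ → ℝ) (l : ℕ) :
    Measurable fun x : Fin n → ℝ => partialSum c (zeroExt x) l := by
  unfold partialSum
  exact Finset.measurable_fun_sum _ fun i _ => (measurable_zeroExt i).const_mul _

theorem measurable_runMax {n : ℕ} (c : ℕ → ℝ) (l : ℕ) :
    Measurable fun x : Fin n → ℝ => runMax (partialSum c (zeroExt x)) l := by
  induction l with
  | zero => exact measurable_partialSum c 0
  | succ l ih => exact ih.max (measurable_partialSum c (l + 1))

theorem partialSum_congr (c : ℕ → ℝ) {x y : ℕ → ℝ} {l : ℕ} (h : ∀ i < l, x i = y i) :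
    partialSum c x l = partialSum c y l :=
  Finset.sum_congr rfl fun i hi => by rw [h i (Finset.mem_range.mp hi)]

section

variable {Ω : Type*} [MeasurableSpace Ω] {μ : Measure Ω} {n : ℕ}
  {e : Fin n → Ω → ℝ}

/-- A functional of the past `e_0, …, e_{i-1}` is independent of `e_i`. -/
theorem indepFun_past (hind : iIndepFun e μ) (hm : ∀ i, Measurable (e i))
    {H : (ℕ → ℝ) → ℝ} (i : Fin n) (hloc : ∀ x y : ℕ → ℝ, (∀ j < (i : ℕ), x j = y j) → H x = H y)
    (hH : Measurable fun x : Fin n → ℝ => H (zeroExt x)) :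
    IndepFun (fun ω => H (zeroExt fun j => e j ω)) (e i) μ := by
  classical
  set S : Finset (Fin n) := Finset.univ.filter (· < i)
  have hd : Disjoint S {i} := by simp [S]
  have h := hind.indepFun_finset S {i} hd hm
  have hψ : Measurable fun x : ({i} : Finset (Fin n)) → ℝ => x ⟨i, Finset.mem_singleton_self i⟩ :=
    measurable_pi_apply _
  have h1 := h.comp (φ := fun x : S → ℝ =>
      H (zeroExt fun j : Fin n => if h : j ∈ S then x ⟨j, h⟩ else 0))
    (hH.comp (measurable_pi_lambda _ fun j => by split_ifs <;> fun_prop)) hψ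
  have heq : (fun ω => H (zeroExt fun j => e j ω)) =
      (fun x : S → ℝ => H (zeroExt fun j : Fin n => if h : j ∈ S then x ⟨j, h⟩ else 0)) ∘
        fun ω (j : S) => e j ω := by
    funext ω
    refine hloc _ _ fun j hj => ?_
    have hjn : j < n := hj.trans i.2
    have hS : (⟨j, hjn⟩ : Fin n) ∈ S := Finset.mem_filter.mpr ⟨Finset.mem_univ _, hj⟩
    simp [zeroExt, hjn, hS]
  rw [heq]
  exact h1

theorem memLp_partialSum (h2 : ∀ i, MemLp (e i) 2 μ) (c : ℕ → ℝ) (l : ℕ) :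
    MemLp (fun ω => partialSum c (zeroExt fun j => e j ω) l) 2 μ := by
  unfold partialSum
  refine memLp_finsetSum _ fun i _ => MemLp.const_mul ?_ _
  unfold zeroExt
  split_ifs with h
  · exact h2 ⟨i, h⟩
  · exact MemLp.zero

theorem memLp_runMax (h2 : ∀ i, MemLp (e i) 2 μ) (c : ℕ → ℝ) (l : ℕ) :
    MemLp (fun ω => runMax (partialSum c (zeroExt fun j => e j ω)) l) 2 μ := by
  induction l with
  | zero => exact memLp_partialSum h2 c 0
  | succ l ih => exact ih.sup (memLp_partialSum h2 c (l + 1))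

/-- A square-integrable functional of the past is orthogonal to `e_i`. -/
theorem integral_past_mul (hind : iIndepFun e μ) (hm : ∀ i, Measurable (e i))
    (h0 : ∀ i, ∫ ω, e i ω ∂μ = 0)
    {H : (ℕ → ℝ) → ℝ} (i : ℕ) (hloc : ∀ x y : ℕ → ℝ, (∀ j < i, x j = y j) → H x = H y)
    (hH : Measurable fun x : Fin n → ℝ => H (zeroExt x)) :
    ∫ ω, H (zeroExt fun j => e j ω) * zeroExt (fun j => e j ω) i ∂μ = 0 := by
  by_cases h : i < n
  · have h1 := (indepFun_past hind hm ⟨i, h⟩ hloc hH).integral_fun_mul_eq_mul_integral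
      (hH.comp (measurable_pi_lambda _ hm)).aestronglyMeasurable (hm _).aestronglyMeasurable
    simp only [zeroExt, h, dif_pos] at h1 ⊢
    rw [h1, h0, mul_zero]
  · simp [zeroExt, h]

theorem integral_sq_partialSum_le [IsProbabilityMeasure μ] (hind : iIndepFun e μ)
    (hm : ∀ i, Measurable (e i))
    (h2 : ∀ i, MemLp (e i) 2 μ) (h0 : ∀ i, ∫ ω, e i ω ∂μ = 0) {τ : ℝ} (hτ0 : 0 ≤ τ)
    (hτ : ∀ i, ∫ ω, e i ω ^ 2 ∂μ ≤ τ) (c : ℕ → ℝ) (l : ℕ) :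
    ∫ ω, partialSum c (zeroExt fun j => e j ω) l ^ 2 ∂μ ≤
      τ * ∑ i ∈ Finset.range l, c i ^ 2 := by
  induction l with
  | zero => simp [partialSum]
  | succ l ih =>
    have hz : MemLp (fun ω => zeroExt (fun j => e j ω) l) 2 μ := by
      unfold zeroExt
      split_ifs with h
      · exact h2 ⟨l, h⟩
      · exact MemLp.zero
    have hzτ : ∫ ω, zeroExt (fun j => e j ω) l ^ 2 ∂μ ≤ τ := by
      unfold zeroExt
      split_ifs with h
      · exact hτ ⟨l, h⟩
      · simpa using hτ0
    have hU := memLp_partialSum h2 c l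
    have horth := integral_past_mul hind hm h0 (H := fun x => partialSum c x l) l
      (fun x y h => partialSum_congr c h) (measurable_partialSum c l)
    have hexp : ∀ ω, partialSum c (zeroExt fun j => e j ω) (l + 1) ^ 2 =
        partialSum c (zeroExt fun j => e j ω) l ^ 2 +
        (2 * c l) * (partialSum c (zeroExt fun j => e j ω) l * zeroExt (fun j => e j ω) l) +
        c l ^ 2 * zeroExt (fun j => e j ω) l ^ 2 := by
      intro ω
      rw [partialSum_succ]
      ring
    have hi1 := hU.integrable_sq
    have hi2 := (hU.integrable_mul hz).const_mul (2 * c l)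
    have hi3 := hz.integrable_sq.const_mul (c l ^ 2)
    simp only [Pi.mul_apply] at hi2
    have hi12 : Integrable (fun ω => partialSum c (zeroExt fun j => e j ω) l ^ 2 +
        (2 * c l) * (partialSum c (zeroExt fun j => e j ω) l * zeroExt (fun j => e j ω) l)) μ :=
      hi1.add hi2
    simp_rw [hexp]
    rw [integral_add hi12 hi3, integral_add hi1 hi2, integral_const_mul,
      integral_const_mul, horth, Finset.sum_range_succ, mul_add]
    have := mul_le_mul_of_nonneg_left hzτ (sq_nonneg (c l))
    linarith

/-- Doob's `L²` maximal inequality for the series `∑ c_i e_i`. -/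
theorem integral_sq_runMax_le [IsProbabilityMeasure μ] (hind : iIndepFun e μ)
    (hm : ∀ i, Measurable (e i))
    (h2 : ∀ i, MemLp (e i) 2 μ) (h0 : ∀ i, ∫ ω, e i ω ∂μ = 0) {τ : ℝ} (hτ0 : 0 ≤ τ)
    (hτ : ∀ i, ∫ ω, e i ω ^ 2 ∂μ ≤ τ) (c : ℕ → ℝ) (l : ℕ) :
    ∫ ω, runMax (partialSum c (zeroExt fun j => e j ω)) l ^ 2 ∂μ ≤
      4 * (τ * ∑ i ∈ Finset.range l, c i ^ 2) := by
  have hz : ∀ i, MemLp (fun ω => zeroExt (fun j => e j ω) i) 2 μ := by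
    intro i
    unfold zeroExt
    split_ifs with h
    · exact h2 ⟨i, h⟩
    · exact MemLp.zero
  have hU := (memLp_partialSum h2 c l).integrable_sq.const_mul 4
  have hRz : ∀ i, Integrable (fun ω => runMax (partialSum c (zeroExt fun j => e j ω)) i *
      zeroExt (fun j => e j ω) i) μ := fun i => (memLp_runMax h2 c i).integrable_mul (hz i)
  have hsum : Integrable (fun ω => ∑ i ∈ Finset.range l,
      c i * (runMax (partialSum c (zeroExt fun j => e j ω)) i * zeroExt (fun j => e j ω) i)) μ :=
    integrable_finsetSum _ fun i _ => (hRz i).const_mul _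
  have hle : ∫ ω, runMax (partialSum c (zeroExt fun j => e j ω)) l ^ 2 ∂μ ≤
      ∫ ω, (4 * partialSum c (zeroExt fun j => e j ω) l ^ 2 - 4 * ∑ i ∈ Finset.range l,
        c i * (runMax (partialSum c (zeroExt fun j => e j ω)) i *
          zeroExt (fun j => e j ω) i)) ∂μ := by
    refine integral_mono (memLp_runMax h2 c l).integrable_sq (hU.sub (hsum.const_mul 4)) fun ω => ?_
    refine (sq_runMax_le (by simp [partialSum]) l).trans (le_of_eq ?_)
    congr 2
    refine Finset.sum_congr rfl fun i _ => ?_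
    rw [partialSum_succ]
    ring
  refine hle.trans ?_
  rw [integral_sub hU (hsum.const_mul 4), integral_const_mul, integral_const_mul,
    integral_finsetSum _ fun i _ => (hRz i).const_mul _]
  have hzero : ∀ i ∈ Finset.range l, ∫ ω, c i * (runMax (partialSum c (zeroExt fun j => e j ω)) i *
          zeroExt (fun j => e j ω) i) ∂μ = 0 := by
    intro i _
    rw [integral_const_mul, integral_past_mul hind hm h0
      (H := fun x => runMax (partialSum c x) i) i
      (fun x y h => runMax_congr fun j hj => partialSum_congr c fun k hk => h k (by omega))
      (measurable_runMax c i), mul_zero]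
  rw [Finset.sum_eq_zero hzero]
  have := integral_sq_partialSum_le hind hm h2 h0 hτ0 hτ c l
  linarith

/-- The square of the maximal average beyond `j` has expectation of order `τ / (j + 1)`. It is
stated through an integrable majorant. -/
theorem exists_majorant_sq_avgSup [IsProbabilityMeasure μ] (hind : iIndepFun e μ)
    (hm : ∀ i, Measurable (e i))
    (h2 : ∀ i, MemLp (e i) 2 μ) (h0 : ∀ i, ∫ ω, e i ω ∂μ = 0) {τ : ℝ} (hτ0 : 0 ≤ τ)
    (hτ : ∀ i, ∫ ω, e i ω ^ 2 ∂μ ≤ τ) (j : ℕ) :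
    ∃ G : Ω → ℝ, Integrable G μ ∧ (∀ ω, avgSup n (zeroExt fun i => e i ω) j ^ 2 ≤ G ω) ∧
      ∫ ω, G ω ∂μ ≤ 32 * τ / (j + 1) := by
  have hneg : ∀ ω, (fun i => -zeroExt (fun i => e i ω) i) = zeroExt (fun i => -e i ω) := by
    intro ω
    funext i
    unfold zeroExt
    split_ifs <;> simp
  have hind' : iIndepFun (fun i ω => -e i ω) μ :=
    hind.comp (fun _ x => -x) fun _ => measurable_neg
  have hA2 := memLp_runMax h2 (harmonicWeight j) n
  have hB2 := memLp_runMax (e := fun i ω => -e i ω) (fun i => (h2 i).neg) (harmonicWeight j) n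
  have hA := integral_sq_runMax_le hind hm h2 h0 hτ0 hτ (harmonicWeight j) n
  have hB := integral_sq_runMax_le (e := fun i ω => -e i ω) hind' (fun i => (hm i).neg)
    (fun i => (h2 i).neg) (fun i => by rw [integral_neg, h0, neg_zero]) hτ0
    (fun i => by simpa using hτ i) (harmonicWeight j) n
  refine ⟨fun ω => 2 * runMax (partialSum (harmonicWeight j) (zeroExt fun i => e i ω)) n ^ 2 +
    2 * runMax (partialSum (harmonicWeight j) (zeroExt fun i => -e i ω)) n ^ 2,
    (hA2.integrable_sq.const_mul 2).add (hB2.integrable_sq.const_mul 2), fun ω => ?_, ?_⟩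
  · have h1 := avgSup_le_runMax n (zeroExt fun i => e i ω) j
    rw [hneg] at h1
    refine (pow_le_pow_left₀ (avgSup_nonneg _ _ _) h1 2).trans ?_
    nlinarith [sq_nonneg (runMax (partialSum (harmonicWeight j) (zeroExt fun i => e i ω)) n -
      runMax (partialSum (harmonicWeight j) (zeroExt fun i => -e i ω)) n)]
  · rw [integral_add (hA2.integrable_sq.const_mul 2) (hB2.integrable_sq.const_mul 2),
      integral_const_mul, integral_const_mul]
    have hw := mul_le_mul_of_nonneg_left (sum_sq_harmonicWeight_le j n) hτ0
    have : 32 * τ / (j + 1) = 16 * (τ * (2 / (j + 1))) := by ring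
    rw [this]
    linarith

end

/-! ### Weighted isotonic least squares -/

/-- First order optimality: the residual makes an obtuse angle with the cone at the fit. -/
theorem IsIsoFit.sum_mul_le_zero {p : ℕ} {w x v u : Fin p → ℝ} (hw : ∀ i, 0 < w i)
    (hv : IsIsoFit w x v) (hu : u ∈ isoCone p) :
    ∑ i, w i * ((x i - v i) * (u i - v i)) ≤ 0 := by
  by_contra! hA
  set A := ∑ i, w i * ((x i - v i) * (u i - v i)) with hAdef
  set B := ∑ i, w i * (u i - v i) ^ 2 with hBdef
  have hB : 0 ≤ B := Finset.sum_nonneg fun i _ => mul_nonneg (hw i).le (sq_nonneg _)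
  set t := A / (A + B) with ht
  have ht0 : 0 < t := by positivity
  have ht1 : t ≤ 1 := by rw [ht, div_le_one (by positivity)]; linarith
  have hmem : (fun i => v i + t * (u i - v i)) ∈ isoCone p := by
    refine ⟨fun i j hij => ?_, fun i => ?_⟩
    · have h1 := hv.1.1 hij
      have h2 := hu.1 hij
      dsimp only
      nlinarith
    · have h1 := hv.1.2 i
      have h2 := hu.2 i
      dsimp only
      nlinarith
  have hexp : isoLoss w x (fun i => v i + t * (u i - v i)) =
      isoLoss w x v - 2 * t * A + t ^ 2 * B := by
    unfold isoLoss
    rw [hAdef, hBdef, Finset.mul_sum, Finset.mul_sum, ← Finset.sum_sub_distrib,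
      ← Finset.sum_add_distrib]
    exact Finset.sum_congr rfl fun i _ => by ring
  have h1 := hv.2 _ hmem
  rw [hexp] at h1
  have h2 : 2 * A ≤ t * B := by
    by_contra! h
    nlinarith
  have h3 : t * (A + B) = A := div_mul_cancel₀ _ (by positivity)
  nlinarith

/-- The isotonic fit is firmly nonexpansive in the data. -/
theorem IsIsoFit.sum_sq_sub_le_inner {p : ℕ} {w x x' v v' : Fin p → ℝ} (hw : ∀ i, 0 < w i)
    (hv : IsIsoFit w x v) (hv' : IsIsoFit w x' v') :
    ∑ i, w i * (v i - v' i) ^ 2 ≤ ∑ i, w i * ((x i - x' i) * (v i - v' i)) := by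
  have h1 := hv.sum_mul_le_zero hw hv'.1
  have h2 := hv'.sum_mul_le_zero hw hv.1
  have h3 : ∑ i, w i * ((x i - v i) * (v' i - v i)) + ∑ i, w i * ((x' i - v' i) * (v i - v' i)) =
      ∑ i, w i * (v i - v' i) ^ 2 - ∑ i, w i * ((x i - x' i) * (v i - v' i)) := by
    rw [← Finset.sum_add_distrib, ← Finset.sum_sub_distrib]
    exact Finset.sum_congr rfl fun i _ => by ring
  linarith

theorem IsIsoFit.sum_sq_sub_le {p : ℕ} {w x x' v v' : Fin p → ℝ} (hw : ∀ i, 0 < w i)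
    (hv : IsIsoFit w x v) (hv' : IsIsoFit w x' v') :
    ∑ i, w i * (v i - v' i) ^ 2 ≤ ∑ i, w i * (x i - x' i) ^ 2 := by
  have h1 := hv.sum_sq_sub_le_inner hw hv'
  have h2 : ∑ i, w i * ((x i - x' i) * (v i - v' i)) ≤
      ∑ i, (w i * (x i - x' i) ^ 2 / 2 + w i * (v i - v' i) ^ 2 / 2) :=
    Finset.sum_le_sum fun i _ => by
      nlinarith [mul_nonneg (hw i).le (sq_nonneg ((x i - x' i) - (v i - v' i)))]
  rw [Finset.sum_add_distrib, ← Finset.sum_div, ← Finset.sum_div] at h2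
  linarith

theorem isIsoFit_self {p : ℕ} {w u : Fin p → ℝ} (hw : ∀ i, 0 < w i) (hu : u ∈ isoCone p) :
    IsIsoFit w u u :=
  ⟨hu, fun v _ => by
    have h0 : isoLoss w u u = 0 := by simp [isoLoss]
    rw [h0]
    exact Finset.sum_nonneg fun i _ => mul_nonneg (hw i).le (sq_nonneg _)⟩

theorem continuous_isoFit {p : ℕ} {w : Fin p → ℝ} (hw : ∀ i, 0 < w i) :
    Continuous (isoFit w) := by
  rw [continuous_iff_continuousAt]
  intro x
  rw [ContinuousAt, tendsto_pi_nhds]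
  intro i
  rw [tendsto_iff_dist_tendsto_zero]
  have hcont : Filter.Tendsto (fun y : Fin p → ℝ => Real.sqrt ((∑ j, w j * (y j - x j) ^ 2) / w i))
      (nhds x) (nhds 0) := by
    have : Continuous fun y : Fin p → ℝ =>
        Real.sqrt ((∑ j, w j * (y j - x j) ^ 2) / w i) := by fun_prop
    simpa using this.tendsto x
  refine squeeze_zero (fun _ => dist_nonneg) (fun y => ?_) hcont
  rw [Real.dist_eq]
  refine Real.abs_le_sqrt ?_
  rw [le_div_iff₀ (hw i), mul_comm]
  have h1 := (isIsoFit_isoFit w y hw).sum_sq_sub_le hw (isIsoFit_isoFit w x hw)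
  exact (Finset.single_le_sum (f := fun j => w j * (isoFit w y j - isoFit w x j) ^ 2)
    (fun j _ => mul_nonneg (hw j).le (sq_nonneg _)) (Finset.mem_univ i)).trans h1

/-- Deterministic oracle inequality: on the support of the target the error is at most the noise,
and on the remaining block it is at most the envelope of maximal averages of the noise. -/
theorem IsIsoFit.sum_sq_sub_le_avgSup {k n : ℕ} {w x v u : Fin (k + n) → ℝ}
    (hw : ∀ i, 0 < w i) (hv : IsIsoFit w x v) (hu : u ∈ isoCone (k + n))
    (hu0 : ∀ j : Fin n, u (Fin.natAdd k j) = 0) {w₀ : ℝ} (hw0 : 0 ≤ w₀)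
    (hw₀ : ∀ j : Fin n, w (Fin.natAdd k j) = w₀) :
    ∑ i, w i * (v i - u i) ^ 2 ≤
      ∑ i : Fin k, w (Fin.castAdd n i) * (x (Fin.castAdd n i) - u (Fin.castAdd n i)) ^ 2 +
      w₀ * ∑ j : Fin n, avgSup n (zeroExt fun j => x (Fin.natAdd k j)) j ^ 2 := by
  have h1 := hv.sum_sq_sub_le_inner hw (isIsoFit_self hw hu)
  rw [Fin.sum_univ_add, Fin.sum_univ_add] at h1
  rw [Fin.sum_univ_add]
  simp only [hu0, hw₀, sub_zero] at h1 ⊢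
  have hhead : ∑ i : Fin k, w (Fin.castAdd n i) * ((x (Fin.castAdd n i) - u (Fin.castAdd n i)) *
        (v (Fin.castAdd n i) - u (Fin.castAdd n i))) ≤
      ∑ i : Fin k, (w (Fin.castAdd n i) * (x (Fin.castAdd n i) - u (Fin.castAdd n i)) ^ 2 / 2 +
        w (Fin.castAdd n i) * (v (Fin.castAdd n i) - u (Fin.castAdd n i)) ^ 2 / 2) := by
    refine Finset.sum_le_sum fun i _ => ?_
    nlinarith [mul_nonneg (hw (Fin.castAdd n i)).le (sq_nonneg
      ((x (Fin.castAdd n i) - u (Fin.castAdd n i)) - (v (Fin.castAdd n i) - u (Fin.castAdd n i))))]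
  rw [Finset.sum_add_distrib, ← Finset.sum_div, ← Finset.sum_div] at hhead
  have htail : ∑ j : Fin n, x (Fin.natAdd k j) * v (Fin.natAdd k j) ≤
      ∑ j : Fin n, avgSup n (zeroExt fun j => x (Fin.natAdd k j)) j * v (Fin.natAdd k j) := by
    have h := sum_mul_le_sum_avgSup_mul (n := n) (zeroExt fun j => x (Fin.natAdd k j))
      (zeroExt fun j => v (Fin.natAdd k j))
      (fun i hi => by
        have hi' : i < n := by omega
        simp only [zeroExt, hi, hi', dif_pos]
        exact hv.1.1 (by simp [Fin.le_def]))
      (fun i hi => by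
        simp only [zeroExt, hi, dif_pos]
        exact hv.1.2 _)
    simpa only [Finset.sum_range, zeroExt_val] using h
  have hsq : ∑ j : Fin n, avgSup n (zeroExt fun j => x (Fin.natAdd k j)) j * v (Fin.natAdd k j) ≤
      ∑ j : Fin n, (avgSup n (zeroExt fun j => x (Fin.natAdd k j)) j ^ 2 / 2 +
        v (Fin.natAdd k j) ^ 2 / 2) := by
    refine Finset.sum_le_sum fun j _ => ?_
    nlinarith [sq_nonneg (avgSup n (zeroExt fun j => x (Fin.natAdd k j)) j -
      v (Fin.natAdd k j))]
  rw [Finset.sum_add_distrib, ← Finset.sum_div, ← Finset.sum_div] at hsq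
  have h2 := mul_le_mul_of_nonneg_left (htail.trans hsq) hw0
  rw [← Finset.mul_sum, ← Finset.mul_sum] at h1
  rw [← Finset.mul_sum]
  linarith

/-! ### Dyadic bins -/

theorem thr_pos {ν : ℝ} (hν : 0 < ν) (m : ℕ) : 0 < thr ν m := by unfold thr; positivity

theorem thr_succ (ν : ℝ) (m : ℕ) : thr ν (m + 1) = 2 * thr ν m := by unfold thr; ring

theorem thr_strictMono {ν : ℝ} (hν : 0 < ν) : StrictMono (thr ν) :=
  strictMono_nat_of_lt_succ fun m => by
    rw [thr_succ]
    linarith [thr_pos hν m]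

theorem bin_unique {p : ℕ} {ν : ℝ} (hν : 0 < ν) {u : Fin p → ℝ} {i : Fin p} {m m' : ℕ}
    (h : i ∈ bin ν u m) (h' : i ∈ bin ν u m') : m = m' := by
  have h1 := (thr_strictMono hν).lt_iff_lt.mp (h.1.trans_lt h'.2)
  have h2 := (thr_strictMono hν).lt_iff_lt.mp (h'.1.trans_lt h.2)
  omega

theorem binWeight_eq {p : ℕ} {R ν : ℝ} (hν : 0 < ν) {u : Fin p → ℝ} {i : Fin p} {m : ℕ}
    (hm : m < numBins R ν) (h : i ∈ bin ν u m) : binWeight R ν u i = 1 / thr ν m := by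
  unfold binWeight
  rw [Finset.sum_eq_single_of_mem m (Finset.mem_range.mpr hm), if_pos h]
  intro b _ hb
  rw [if_neg fun hi => hb (bin_unique hν hi h)]

theorem exists_mem_bin {p : ℕ} {R ν : ℝ} (hν : 0 < ν) {u : Fin p → ℝ}
    (hu0 : ∀ i, 0 ≤ u i) (huR : ∀ i, u i ≤ R) (i : Fin p) :
    ∃ m < numBins R ν, i ∈ bin ν u m := by
  by_contra! h
  have h0 := binWeight_pos hν hu0 huR i
  unfold binWeight at h0
  rw [Finset.sum_eq_zero fun m hm => if_neg (h m (Finset.mem_range.mp hm))] at h0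
  exact lt_irrefl _ h0

/-- A profile whose bins are correct for `v` has the weights of `v`. -/
theorem binWeight_congr {p : ℕ} {R ν : ℝ} (hν : 0 < ν) {u v : Fin p → ℝ}
    (hu0 : ∀ i, 0 ≤ u i) (huR : ∀ i, u i ≤ R)
    (h : ∀ m < numBins R ν, ∀ i ∈ bin ν u m, i ∈ bin ν v m) :
    binWeight R ν u = binWeight R ν v := by
  funext i
  obtain ⟨m, hm, hi⟩ := exists_mem_bin hν hu0 huR i
  rw [binWeight_eq hν hm hi, binWeight_eq hν hm (h m hm i hi)]

theorem one_div_le_binWeight {p : ℕ} {R ν : ℝ} (hν : 0 < ν) {u : Fin p → ℝ}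
    (hu0 : ∀ i, 0 ≤ u i) (huR : ∀ i, u i ≤ R) (i : Fin p) :
    1 / (u i + ν) ≤ binWeight R ν u i := by
  obtain ⟨m, hm, hi⟩ := exists_mem_bin hν hu0 huR i
  rw [binWeight_eq hν hm hi]
  exact one_div_le_one_div_of_le (thr_pos hν m) hi.1

theorem binWeight_le {p : ℕ} {R ν : ℝ} (hν : 0 < ν) {u : Fin p → ℝ}
    (hu0 : ∀ i, 0 ≤ u i) (huR : ∀ i, u i ≤ R) (i : Fin p) :
    binWeight R ν u i ≤ 2 / (u i + ν) := by
  obtain ⟨m, hm, hi⟩ := exists_mem_bin hν hu0 huR i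
  rw [binWeight_eq hν hm hi]
  have h1 := hi.2
  rw [thr_succ] at h1
  have := thr_pos hν m
  have := hu0 i
  rw [div_le_div_iff₀ (by assumption) (by positivity)]
  linarith

theorem binWeight_of_eq_zero {p : ℕ} {R ν : ℝ} (hν : 0 < ν) {u : Fin p → ℝ}
    (hu0 : ∀ i, 0 ≤ u i) (huR : ∀ i, u i ≤ R) {i : Fin p} (h0 : u i = 0) :
    binWeight R ν u i = 1 / ν := by
  obtain ⟨m, hm, hi⟩ := exists_mem_bin hν hu0 huR i
  have h1 := hi.1
  rw [h0, zero_add] at h1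
  have h2 : m = 0 := by
    by_contra h
    have := (thr_strictMono hν) (Nat.pos_of_ne_zero h)
    simp [thr] at this h1
    linarith
  rw [binWeight_eq hν hm hi, h2]
  simp [thr]

/-! ### Shrinkage with an estimated variance profile -/

/-- The risk of shrinking by `v / (v + ν)`, for a target `u` that agrees with the signal strength
`V` up to the factor `A`. -/
theorem shrink_risk_le {ν V A u v : ℝ} (hν : 0 < ν) (hA : 1 ≤ A) (hu : 0 ≤ u) (hV : V = A * u)
    (hv : 0 ≤ v) :
    ν * (v / (v + ν)) ^ 2 + V * (1 - v / (v + ν)) ^ 2 ≤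
      A * (u * ν / (u + ν) + (v - u) ^ 2 / (u + ν)) := by
  have hvν : 0 < v + ν := by linarith
  have huν : 0 < u + ν := by linarith
  have h1 : ν * (v / (v + ν)) ^ 2 + u * (1 - v / (v + ν)) ^ 2 ≤
      u * ν / (u + ν) + (v - u) ^ 2 / (u + ν) := by
    have h2 : 1 - v / (v + ν) = ν / (v + ν) := by field_simp; ring
    rw [h2, div_pow, div_pow, ← add_div, mul_div_assoc', mul_div_assoc', ← add_div,
      div_le_div_iff₀ (by positivity) huν]
    have h3 : 0 ≤ (v - u) ^ 2 * (v ^ 2 + 2 * v * ν) := by positivity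
    nlinarith
  have h4 : ν * (v / (v + ν)) ^ 2 ≤ A * (ν * (v / (v + ν)) ^ 2) :=
    le_mul_of_one_le_left (by positivity) hA
  have h5 := mul_le_mul_of_nonneg_left h1 (by linarith : 0 ≤ A)
  rw [hV]
  linarith

/-! ### Gaussian vectors -/

instance isProbabilityMeasure_gaussVec {p : ℕ} (θ : Fin p → ℝ) (v : ℝ) :
    IsProbabilityMeasure (gaussVec θ v) := by unfold gaussVec; infer_instance

theorem charFunDual_gaussianReal (m : ℝ) (v : ℝ≥0) (L : StrongDual ℝ ℝ) :
    charFunDual (gaussianReal m v) L =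
      Complex.exp (L 1 * m * Complex.I - v * (L 1) ^ 2 / 2) := by
  have h : L m = L 1 * m := by
    have := L.map_smul m 1
    simp only [smul_eq_mul, mul_one] at this
    rw [this, mul_comm]
  rw [charFunDual_eq_charFun_map_one, gaussianReal_map_continuousLinearMap, charFun_gaussianReal, h]
  congr 1
  simp [max_eq_left (sq_nonneg (L 1))]
  ring

/-- The sum and the difference of independent Gaussians of equal variance are independent. -/
theorem map_add_sub_gaussianReal (m m' : ℝ) (v : ℝ≥0) :
    ((gaussianReal m v).prod (gaussianReal m' v)).map (fun z => (z.1 + z.2, z.1 - z.2)) =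
      (gaussianReal (m + m') (2 * v)).prod (gaussianReal (m - m') (2 * v)) := by
  set T : ℝ × ℝ →L[ℝ] ℝ × ℝ :=
    (ContinuousLinearMap.fst ℝ ℝ ℝ + ContinuousLinearMap.snd ℝ ℝ ℝ).prod
      (ContinuousLinearMap.fst ℝ ℝ ℝ - ContinuousLinearMap.snd ℝ ℝ ℝ) with hT
  have hfun : (fun z : ℝ × ℝ => (z.1 + z.2, z.1 - z.2)) = T := rfl
  rw [hfun]
  have : IsProbabilityMeasure (((gaussianReal m v).prod (gaussianReal m' v)).map T) :=
    Measure.isProbabilityMeasure_map (by fun_prop)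
  refine Measure.ext_of_charFunDual ?_
  ext L
  rw [charFunDual_map, charFunDual_prod, charFunDual_prod]
  simp only [charFunDual_gaussianReal, ← Complex.exp_add]
  have h1 : (L.comp T) (1, 0) = L (1, 0) + L (0, 1) := by
    rw [← map_add]
    simp [hT]
  have h2 : (L.comp T) (0, 1) = L (1, 0) - L (0, 1) := by
    rw [← map_sub]
    simp [hT]
  simp only [ContinuousLinearMap.comp_apply, ContinuousLinearMap.inl_apply,
    ContinuousLinearMap.inr_apply] at h1 h2 ⊢
  rw [h1, h2]
  congr 1
  push_cast
  ring

/-- The sum and the difference of independent Gaussian vectors of equal variance are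
independent. -/
theorem measurePreserving_add_sub_gaussVec {p : ℕ} (θ η : Fin p → ℝ) (v : ℝ) :
    MeasurePreserving (fun z : (Fin p → ℝ) × (Fin p → ℝ) => (z.1 + z.2, z.1 - z.2))
      ((gaussVec θ v).prod (gaussVec η v))
      ((gaussVec (θ + η) (2 * v)).prod (gaussVec (θ - η) (2 * v))) := by
  have h1 := (measurePreserving_arrowProdEquivProdArrow ℝ ℝ (Fin p)
    (fun i => gaussianReal (θ i) v.toNNReal) (fun i => gaussianReal (η i) v.toNNReal)).symm
  have h2 := measurePreserving_pi
    (fun i => (gaussianReal (θ i) v.toNNReal).prod (gaussianReal (η i) v.toNNReal))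
    (fun i => (gaussianReal (θ i + η i) (2 * v.toNNReal)).prod
      (gaussianReal (θ i - η i) (2 * v.toNNReal)))
    (f := fun _ z => (z.1 + z.2, z.1 - z.2))
    fun i => ⟨by fun_prop, map_add_sub_gaussianReal (θ i) (η i) v.toNNReal⟩
  have h3 := measurePreserving_arrowProdEquivProdArrow ℝ ℝ (Fin p)
    (fun i => gaussianReal (θ i + η i) (2 * v.toNNReal))
    (fun i => gaussianReal (θ i - η i) (2 * v.toNNReal))
  have hv : (2 * v).toNNReal = 2 * v.toNNReal := by
    rw [Real.toNNReal_mul zero_le_two]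
    simp
  unfold gaussVec
  rw [hv]
  exact h3.comp (h2.comp h1)

instance isOpenPosMeasure_gaussianReal (m : ℝ) (v : ℝ≥0) [hv : NeZero v] :
    (gaussianReal m v).IsOpenPosMeasure :=
  (gaussianReal_absolutelyContinuous' m hv.out).isOpenPosMeasure

theorem isOpenPosMeasure_gaussVec {p : ℕ} (θ : Fin p → ℝ) {v : ℝ} (hv : 0 < v) :
    (gaussVec θ v).IsOpenPosMeasure := by
  have : NeZero v.toNNReal := ⟨(Real.toNNReal_pos.mpr hv).ne'⟩
  unfold gaussVec
  infer_instance

theorem memLp_id_gaussianReal_nat (m : ℝ) (v : ℝ≥0) (q : ℕ) :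
    MemLp (fun x : ℝ => x) q (gaussianReal m v) :=
  memLp_id_gaussianReal' q (ENNReal.natCast_ne_top q)

theorem integrable_pow_gaussianReal (m : ℝ) (v : ℝ≥0) (q : ℕ) :
    Integrable (fun x => (x - m) ^ q) (gaussianReal m v) := by
  have h : MemLp (fun x : ℝ => x - m) q (gaussianReal m v) :=
    (memLp_id_gaussianReal_nat m v q).sub (memLp_const m)
  have h1 := h.integrable_norm_pow'
  refine h1.mono' (by fun_prop) (ae_of_all _ fun x => ?_)
  rw [norm_pow]

theorem integral_sub_mean_gaussianReal (m : ℝ) (v : ℝ≥0) :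
    ∫ x, (x - m) ∂gaussianReal m v = 0 := by
  rw [integral_sub (by simpa using (memLp_id_gaussianReal_nat m v 1).integrable (by simp))
    (integrable_const _), integral_id_gaussianReal]
  simp

theorem integral_sub_mean_sq_gaussianReal (m : ℝ) (v : ℝ≥0) :
    ∫ x, (x - m) ^ 2 ∂gaussianReal m v = v := by
  have h := variance_fun_id_gaussianReal (μ := m) (v := v)
  rw [variance_eq_integral (by fun_prop), integral_id_gaussianReal] at h
  exact h

theorem integral_sub_mean_pow_four_gaussianReal_le (m : ℝ) {v : ℝ≥0} (hv : 0 < v) :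
    ∫ x, (x - m) ^ 4 ∂gaussianReal m v ≤ 96 * (v : ℝ) ^ 2 := by
  have hv' : (0 : ℝ) < v := hv
  -- the exponential is tested at the inverse standard deviation
  set t : ℝ := 1 / Real.sqrt v with ht
  have ht2 : t ^ 2 = 1 / v := by rw [ht, div_pow, Real.sq_sqrt hv'.le, one_pow]
  have ht0 : 0 < t := by positivity
  have hE : ∀ s : ℝ, Integrable (fun x => Real.exp (s * (x - m))) (gaussianReal m v) := by
    intro s
    have := (integrable_exp_mul_gaussianReal (μ := m) (v := v) s).const_mul (Real.exp (-(s * m)))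
    refine this.congr (ae_of_all _ fun x => ?_)
    dsimp only
    rw [← Real.exp_add]
    ring_nf
  have hI : ∀ s : ℝ, ∫ x, Real.exp (s * (x - m)) ∂gaussianReal m v =
      Real.exp (v * s ^ 2 / 2) := by
    intro s
    have h1 : ∀ x, Real.exp (s * (x - m)) = Real.exp (-(s * m)) * Real.exp (s * x) := by
      intro x
      rw [← Real.exp_add]
      ring_nf
    have h2 := congrFun (mgf_fun_id_gaussianReal (μ := m) (v := v)) s
    unfold mgf at h2
    simp_rw [h1]
    rw [integral_const_mul, h2, ← Real.exp_add]
    ring_nf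
  have hpt : ∀ x : ℝ, (x - m) ^ 4 ≤ 24 * (v : ℝ) ^ 2 *
      (Real.exp (t * (x - m)) + Real.exp (-t * (x - m))) := by
    intro x
    have h1 := Real.pow_div_factorial_le_exp _ (abs_nonneg (t * (x - m))) 4
    have h2 : Real.exp |t * (x - m)| ≤ Real.exp (t * (x - m)) + Real.exp (-t * (x - m)) := by
      rcases abs_cases (t * (x - m)) with ⟨h, _⟩ | ⟨h, _⟩
      · rw [h]
        linarith [Real.exp_pos (-t * (x - m))]
      · rw [h, neg_mul]
        linarith [Real.exp_pos (t * (x - m))]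
    have h3 : |t * (x - m)| ^ 4 = (x - m) ^ 4 / (v : ℝ) ^ 2 := by
      rw [Even.pow_abs (by decide), mul_pow, show t ^ 4 = (t ^ 2) ^ 2 by ring, ht2]
      field_simp
    rw [h3] at h1
    have h4 : ((Nat.factorial 4 : ℕ) : ℝ) = 24 := by norm_num [Nat.factorial]
    rw [h4, div_div, div_le_iff₀ (by positivity)] at h1
    nlinarith [sq_nonneg (v : ℝ)]
  have hexp : Real.exp (1 / 2) ≤ 2 := by
    have h1 := Real.exp_one_lt_d9
    have h2 : Real.exp (1 / 2) ^ 2 = Real.exp 1 := by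
      rw [← Real.exp_nat_mul]
      norm_num
    nlinarith [Real.exp_pos (1 / 2)]
  calc ∫ x, (x - m) ^ 4 ∂gaussianReal m v
      ≤ ∫ x, 24 * (v : ℝ) ^ 2 * (Real.exp (t * (x - m)) + Real.exp (-t * (x - m)))
          ∂gaussianReal m v :=
        integral_mono (integrable_pow_gaussianReal m v 4) (((hE t).add (hE (-t))).const_mul _) hpt
    _ = 24 * (v : ℝ) ^ 2 * (Real.exp (1 / 2) + Real.exp (1 / 2)) := by
        rw [integral_const_mul, integral_add (hE t) (hE (-t)), hI, hI, neg_sq, ht2]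
        congr 3 <;> field_simp
    _ ≤ 96 * (v : ℝ) ^ 2 := by nlinarith [sq_nonneg (v : ℝ)]

/-- The squared observation, centred at its mean. -/
def sqNoise (m v x : ℝ) : ℝ := x ^ 2 - v - m ^ 2

theorem measurable_sqNoise (m v : ℝ) : Measurable (sqNoise m v) := by
  unfold sqNoise
  fun_prop

theorem sqNoise_eq (m v x : ℝ) :
    sqNoise m v x = 2 * m * (x - m) + ((x - m) ^ 2 - v) := by
  unfold sqNoise
  ring

theorem sq_sqNoise_le (m x : ℝ) {v : ℝ} (hv : 0 ≤ v) :
    sqNoise m v x ^ 2 ≤ 8 * m ^ 2 * (x - m) ^ 2 + 2 * (x - m) ^ 4 + 2 * v ^ 2 := by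
  rw [sqNoise_eq]
  have h1 : 0 ≤ v * (x - m) ^ 2 := mul_nonneg hv (sq_nonneg _)
  nlinarith [sq_nonneg (2 * m * (x - m) - ((x - m) ^ 2 - v))]

theorem integrable_sqNoise_majorant (m : ℝ) (v : ℝ≥0) :
    Integrable (fun x => 8 * m ^ 2 * (x - m) ^ 2 + 2 * (x - m) ^ 4 + 2 * (v : ℝ) ^ 2)
      (gaussianReal m v) :=
  (((integrable_pow_gaussianReal m v 2).const_mul _).add
    ((integrable_pow_gaussianReal m v 4).const_mul _)).add (integrable_const _)

theorem memLp_sqNoise (m : ℝ) (v : ℝ≥0) : MemLp (sqNoise m v) 2 (gaussianReal m v) := by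
  rw [memLp_two_iff_integrable_sq (measurable_sqNoise _ _).aestronglyMeasurable]
  refine (integrable_sqNoise_majorant m v).mono'
    ((measurable_sqNoise _ _).pow_const 2).aestronglyMeasurable (ae_of_all _ fun x => ?_)
  rw [Real.norm_of_nonneg (sq_nonneg _)]
  exact sq_sqNoise_le m x v.2

theorem integral_sqNoise (m : ℝ) (v : ℝ≥0) : ∫ x, sqNoise m v x ∂gaussianReal m v = 0 := by
  have h1 := integrable_pow_gaussianReal m v 1
  have h2 := integrable_pow_gaussianReal m v 2
  simp only [pow_one] at h1
  have h3 : Integrable (fun x => (x - m) ^ 2 - (v : ℝ)) (gaussianReal m v) :=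
    h2.sub (integrable_const _)
  simp_rw [sqNoise_eq]
  rw [integral_add (h1.const_mul _) h3,
    integral_sub h2 (integrable_const _), integral_const_mul, integral_sub_mean_gaussianReal,
    integral_sub_mean_sq_gaussianReal]
  simp

theorem integral_sq_sqNoise_le (m : ℝ) {v : ℝ≥0} (hv : 0 < v) :
    ∫ x, sqNoise m v x ^ 2 ∂gaussianReal m v ≤ 200 * v * (v + m ^ 2) := by
  have h2 := (integrable_pow_gaussianReal m v 2).const_mul (8 * m ^ 2)
  have h4 := (integrable_pow_gaussianReal m v 4).const_mul 2
  have h24 : Integrable (fun x => 8 * m ^ 2 * (x - m) ^ 2 + 2 * (x - m) ^ 4)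
    (gaussianReal m v) := h2.add h4
  have h := integral_mono (memLp_sqNoise m v).integrable_sq (integrable_sqNoise_majorant m v)
    fun x => sq_sqNoise_le m x v.2
  rw [integral_add h24 (integrable_const _), integral_add h2 h4, integral_const_mul,
    integral_const_mul, integral_sub_mean_sq_gaussianReal] at h
  have h5 := integral_sub_mean_pow_four_gaussianReal_le m hv
  have h6 : 0 ≤ m ^ 2 * (v : ℝ) := by positivity
  have h7 : 0 ≤ (v : ℝ) ^ 2 := by positivity
  simp at h
  nlinarith

theorem integrable_shrink (m c : ℝ) (v : ℝ≥0) :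
    Integrable (fun x => (c * x - m) ^ 2) (gaussianReal m v) :=
  (((memLp_id_gaussianReal_nat m v 2).const_mul c).sub (memLp_const m)).integrable_sq

/-- The risk of a fixed shrinkage factor: variance plus squared bias. -/
theorem integral_shrink (m c : ℝ) (v : ℝ≥0) :
    ∫ x, (c * x - m) ^ 2 ∂gaussianReal m v = v * c ^ 2 + m ^ 2 * (1 - c) ^ 2 := by
  have h1 := integrable_pow_gaussianReal m v 1
  have h2 := integrable_pow_gaussianReal m v 2
  simp only [pow_one] at h1
  have hexp : ∀ x, (c * x - m) ^ 2 =
      c ^ 2 * (x - m) ^ 2 + (-2 * c * (1 - c) * m) * (x - m) + m ^ 2 * (1 - c) ^ 2 := by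
    intro x
    ring
  have h12 : Integrable (fun x => c ^ 2 * (x - m) ^ 2 + (-2 * c * (1 - c) * m) * (x - m))
    (gaussianReal m v) := (h2.const_mul _).add (h1.const_mul _)
  simp_rw [hexp]
  rw [integral_add h12 (integrable_const _), integral_add (h2.const_mul _) (h1.const_mul _),
    integral_const_mul, integral_const_mul, integral_sub_mean_gaussianReal,
    integral_sub_mean_sq_gaussianReal]
  simp
  ring

theorem integrable_eval_gaussVec {p : ℕ} {θ : Fin p → ℝ} {v : ℝ} {i : Fin p} {f : ℝ → ℝ}
    (hf : Integrable f (gaussianReal (θ i) v.toNNReal)) :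
    Integrable (fun x => f (x i)) (gaussVec θ v) :=
  (measurePreserving_eval (fun i => gaussianReal (θ i) v.toNNReal) i).integrable_comp_of_integrable hf

theorem integral_eval_gaussVec {p : ℕ} (θ : Fin p → ℝ) (v : ℝ) (i : Fin p) {f : ℝ → ℝ}
    (hf : AEStronglyMeasurable f (gaussianReal (θ i) v.toNNReal)) :
    ∫ x, f (x i) ∂gaussVec θ v = ∫ x, f x ∂gaussianReal (θ i) v.toNNReal :=
  integral_comp_eval (μ := fun i => gaussianReal (θ i) v.toNNReal) hf

theorem lintegral_sqLoss_shrink {p : ℕ} (θ c : Fin p → ℝ) {v : ℝ} (hv : 0 ≤ v) :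
    ∫⁻ x, sqLoss (fun i => c i * x i) θ ∂gaussVec θ v =
      ENNReal.ofReal (∑ i, (v * c i ^ 2 + θ i ^ 2 * (1 - c i) ^ 2)) := by
  have hint : ∀ i, Integrable (fun x : Fin p → ℝ => (c i * x i - θ i) ^ 2) (gaussVec θ v) :=
    fun i => integrable_eval_gaussVec (f := fun x => (c i * x - θ i) ^ 2)
      (integrable_shrink (θ i) (c i) _)
  unfold sqLoss
  rw [← ofReal_integral_eq_lintegral_ofReal (integrable_finsetSum _ fun i _ => hint i)
    (ae_of_all _ fun x => Finset.sum_nonneg fun i _ => sq_nonneg _),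
    integral_finsetSum _ fun i _ => hint i]
  congr 1
  refine Finset.sum_congr rfl fun i _ => ?_
  rw [integral_eval_gaussVec θ v i (f := fun x => (c i * x - θ i) ^ 2) (by fun_prop),
    integral_shrink, Real.coe_toNNReal _ hv]

/-! ### The estimator with the oracle weights -/

/-- The centred second moment proxy of an observation vector. -/
noncomputable def sqProxy {p : ℕ} (a ν : ℝ) (g : Fin p → ℝ) (i : Fin p) : ℝ := (g i / a) ^ 2 - 2 * ν / a ^ 2

/-- The isotonic profile of an observation vector for given weights, truncated at `R`. -/
noncomputable def profile {p : ℕ} (a R ν : ℝ) (w g : Fin p → ℝ) (i : Fin p) : ℝ :=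
  min (isoFit w (sqProxy a ν g) i) R

/-- The shrinkage factors built from a profile. -/
noncomputable def shrinkage {p : ℕ} (a R ν : ℝ) (w g : Fin p → ℝ) (i : Fin p) : ℝ :=
  profile a R ν w g i / (profile a R ν w g i + ν)

theorem profile_nonneg {p : ℕ} {a R ν : ℝ} (hR : 0 ≤ R) {w : Fin p → ℝ} (hw : ∀ i, 0 < w i)
    (g : Fin p → ℝ) (i : Fin p) : 0 ≤ profile a R ν w g i :=
  le_min ((isIsoFit_isoFit w _ hw).1.2 i) hR

theorem continuous_sqProxy {p : ℕ} (a ν : ℝ) :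
    Continuous (sqProxy a ν : (Fin p → ℝ) → Fin p → ℝ) := by
  unfold sqProxy
  fun_prop

theorem continuous_profile {p : ℕ} (a R ν : ℝ) {w : Fin p → ℝ} (hw : ∀ i, 0 < w i) (i : Fin p) :
    Continuous fun g => profile a R ν w g i :=
  ((continuous_apply i).comp ((continuous_isoFit hw).comp (continuous_sqProxy a ν))).min
    continuous_const

theorem continuous_shrinkage {p : ℕ} {a R ν : ℝ} (hν : 0 < ν) (hR : 0 ≤ R) {w : Fin p → ℝ}
    (hw : ∀ i, 0 < w i) (i : Fin p) : Continuous fun g => shrinkage a R ν w g i :=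
  (continuous_profile a R ν hw i).div ((continuous_profile a R ν hw i).add continuous_const)
    fun g => by
      have := profile_nonneg (a := a) (ν := ν) hR hw g i
      positivity

theorem sqProxy_sub_eq {p : ℕ} (a ν : ℝ) (θ g : Fin p → ℝ) (i : Fin p) :
    sqProxy a ν g i - θ i ^ 2 / a ^ 2 = sqNoise (θ i) (2 * ν) (g i) / a ^ 2 := by
  unfold sqProxy sqNoise
  rw [div_pow]
  ring

/-- Deterministic risk bound: given the fold on which the profile is fitted, the risk is controlled
by the noise on the support and the envelope of maximal averages off the support. The isotonic fit
estimates `θ² / a²`, which costs only a factor `a² ≤ 2` in the shrinkage risk. -/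
theorem sum_shrink_risk_le {k n : ℕ} {θ : Fin (k + n) → ℝ} {a R ν : ℝ} (hν : 0 < ν)
    (ha1 : 1 ≤ a ^ 2) (ha2 : a ^ 2 ≤ 2) (hanti : Antitone fun i => θ i ^ 2)
    (hR : ∀ i, θ i ^ 2 ≤ R) (hR0 : 0 ≤ R) (h0 : ∀ j : Fin n, θ (Fin.natAdd k j) = 0)
    (g : Fin (k + n) → ℝ) :
    ∑ i, (ν * shrinkage a R ν (binWeight R ν fun i => θ i ^ 2) g i ^ 2 +
        θ i ^ 2 * (1 - shrinkage a R ν (binWeight R ν fun i => θ i ^ 2) g i) ^ 2) ≤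
      2 * (k * ν) + 4 * (∑ i : Fin k, 2 / (θ (Fin.castAdd n i) ^ 2 + ν) *
          sqNoise (θ (Fin.castAdd n i)) (2 * ν) (g (Fin.castAdd n i)) ^ 2 +
        1 / ν * ∑ j : Fin n,
          avgSup n (zeroExt fun j => sqProxy a ν g (Fin.natAdd k j)) j ^ 2) := by
  set w := binWeight R ν fun i => θ i ^ 2 with hwdef
  have hV0 : ∀ i, 0 ≤ θ i ^ 2 := fun i => sq_nonneg _
  have hw : ∀ i, 0 < w i := binWeight_pos hν hV0 hR
  set u : Fin (k + n) → ℝ := fun i => θ i ^ 2 / a ^ 2 with hu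
  have ha0 : 0 < a ^ 2 := by linarith
  have hane : a ≠ 0 := by
    rintro rfl
    norm_num at ha0
  have hu0 : ∀ i, 0 ≤ u i := fun i => div_nonneg (hV0 i) ha0.le
  have huV : ∀ i, u i ≤ θ i ^ 2 := fun i => div_le_self (hV0 i) ha1
  have hucone : u ∈ isoCone (k + n) :=
    ⟨fun i j hij => div_le_div_of_nonneg_right (hanti hij) ha0.le, hu0⟩
  set v := isoFit w (sqProxy a ν g) with hv
  have hfit : IsIsoFit w (sqProxy a ν g) v := isIsoFit_isoFit _ _ hw
  have hiso := hfit.sum_sq_sub_le_avgSup hw hucone (fun j => by simp [hu, h0]) (w₀ := 1 / ν)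
    (by positivity) (fun j => binWeight_of_eq_zero hν hV0 hR (by simp [h0]))
  have hcoord : ∀ i, ν * shrinkage a R ν w g i ^ 2 + θ i ^ 2 * (1 - shrinkage a R ν w g i) ^ 2 ≤
      2 * (u i * ν / (u i + ν)) + 4 * (w i * (v i - u i) ^ 2) := by
    intro i
    have hp0 := profile_nonneg (a := a) (ν := ν) hR0 hw g i
    have h1 := shrink_risk_le (V := θ i ^ 2) hν ha1 (hu0 i)
      (by simp only [hu]; field_simp) hp0
    have h2 : (profile a R ν w g i - u i) ^ 2 ≤ (v i - u i) ^ 2 := by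
      have h3 : profile a R ν w g i = min (v i) R := rfl
      rw [h3]
      rcases le_total (v i) R with h | h
      · rw [min_eq_left h]
      · rw [min_eq_right h]
        have := (huV i).trans (hR i)
        nlinarith
    have huν : 0 < u i + ν := by linarith [hu0 i]
    have h4 : (profile a R ν w g i - u i) ^ 2 / (u i + ν) ≤ 2 * (w i * (v i - u i) ^ 2) := by
      have h5 : 1 / (u i + ν) ≤ 2 * w i := by
        have h6 := one_div_le_binWeight hν hV0 hR i
        have h7 : 1 / (u i + ν) ≤ 2 * (1 / (θ i ^ 2 + ν)) := by
          have h8 : θ i ^ 2 = a ^ 2 * u i := by simp only [hu]; field_simp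
          have h9 : 0 < θ i ^ 2 + ν := by linarith [hV0 i]
          rw [mul_one_div, div_le_div_iff₀ huν h9, h8]
          nlinarith [hu0 i]
        linarith
      rw [div_eq_mul_one_div, mul_comm]
      calc 1 / (u i + ν) * (profile a R ν w g i - u i) ^ 2 ≤ 2 * w i * (v i - u i) ^ 2 := by
            have := (hw i).le
            gcongr
        _ = _ := by ring
    have h10 : 0 ≤ u i * ν / (u i + ν) + (profile a R ν w g i - u i) ^ 2 / (u i + ν) :=
      add_nonneg (div_nonneg (mul_nonneg (hu0 i) hν.le) huν.le) (div_nonneg (sq_nonneg _) huν.le)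
    have h11 := mul_le_mul_of_nonneg_right ha2 h10
    unfold shrinkage
    linarith
  have hbias : ∑ i, u i * ν / (u i + ν) ≤ k * ν := by
    rw [Fin.sum_univ_add]
    have hz : ∀ j : Fin n, u (Fin.natAdd k j) = 0 := fun j => by simp [hu, h0]
    simp only [hz, zero_mul, zero_div, Finset.sum_const_zero, add_zero]
    refine (Finset.sum_le_sum (g := fun _ => ν) fun i _ => ?_).trans (by simp)
    have := hu0 (Fin.castAdd n i)
    rw [div_le_iff₀ (by positivity)]
    nlinarith
  have hhead : ∑ i : Fin k, w (Fin.castAdd n i) *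
      (sqProxy a ν g (Fin.castAdd n i) - u (Fin.castAdd n i)) ^ 2 ≤
      ∑ i : Fin k, 2 / (θ (Fin.castAdd n i) ^ 2 + ν) *
          sqNoise (θ (Fin.castAdd n i)) (2 * ν) (g (Fin.castAdd n i)) ^ 2 := by
    refine Finset.sum_le_sum fun i _ => ?_
    have h1 := binWeight_le hν hV0 hR (Fin.castAdd n i)
    have h2 : (sqProxy a ν g (Fin.castAdd n i) - u (Fin.castAdd n i)) ^ 2 ≤
        sqNoise (θ (Fin.castAdd n i)) (2 * ν) (g (Fin.castAdd n i)) ^ 2 := by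
      simp only [hu]
      rw [sqProxy_sub_eq, div_pow]
      exact div_le_self (sq_nonneg _) (one_le_pow₀ ha1)
    have := (hw (Fin.castAdd n i)).le
    gcongr
  calc _ ≤ ∑ i, (2 * (u i * ν / (u i + ν)) + 4 * (w i * (v i - u i) ^ 2)) :=
        Finset.sum_le_sum fun i _ => hcoord i
    _ = 2 * ∑ i, u i * ν / (u i + ν) + 4 * ∑ i, w i * (v i - u i) ^ 2 := by
        rw [Finset.sum_add_distrib, Finset.mul_sum, Finset.mul_sum]
    _ ≤ _ := by linarith

theorem iIndepFun_gaussVec {p : ℕ} (θ : Fin p → ℝ) (v : ℝ) {f : Fin p → ℝ → ℝ}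
    (hf : ∀ i, Measurable (f i)) : iIndepFun (fun i (x : Fin p → ℝ) => f i (x i)) (gaussVec θ v) :=
  iIndepFun_pi (μ := fun i => gaussianReal (θ i) v.toNNReal) fun i => (hf i).aemeasurable

theorem oracleRisk_le {k n : ℕ} {θ : Fin (k + n) → ℝ} {a R ν : ℝ} (hν : 0 < ν)
    (ha1 : 1 ≤ a ^ 2) (ha2 : a ^ 2 ≤ 2) (hanti : Antitone fun i => θ i ^ 2)
    (hR : ∀ i, θ i ^ 2 ≤ R) (hR0 : 0 ≤ R) (h0 : ∀ j : Fin n, θ (Fin.natAdd k j) = 0) :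
    ∫⁻ g, ∫⁻ x, sqLoss (fun i => shrinkage a R ν (binWeight R ν fun i => θ i ^ 2) g i * x i) θ
        ∂gaussVec θ ν ∂gaussVec θ (2 * ν) ≤
      ENNReal.ofReal (102400 * ν * (k + ∑ j : Fin n, 1 / ((j : ℝ) + 1))) := by
  set P := gaussVec θ (2 * ν) with hP
  have h2ν : 0 < 2 * ν := by linarith
  have hcoe : ((2 * ν).toNNReal : ℝ) = 2 * ν := Real.coe_toNNReal _ h2ν.le
  have hpos : 0 < (2 * ν).toNNReal := Real.toNNReal_pos.mpr h2ν
  have hsq : ∀ i, Integrable (fun x => sqNoise (θ i) (2 * ν) x ^ 2)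
      (gaussianReal (θ i) (2 * ν).toNNReal) := by
    intro i
    have := (memLp_sqNoise (θ i) (2 * ν).toNNReal).integrable_sq
    rwa [hcoe] at this
  have hnoise : ∀ i, ∫ g, sqNoise (θ i) (2 * ν) (g i) ^ 2 ∂P ≤
      400 * ν * (2 * ν + θ i ^ 2) := by
    intro i
    rw [hP, integral_eval_gaussVec θ (2 * ν) i (f := fun x => sqNoise (θ i) (2 * ν) x ^ 2)
      (hsq i).aestronglyMeasurable]
    have := integral_sq_sqNoise_le (θ i) hpos
    rw [hcoe] at this
    linarith
  -- the noise on the complement of the support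
  set e : Fin n → (Fin (k + n) → ℝ) → ℝ := fun j g => sqProxy a ν g (Fin.natAdd k j) with he
  have he' : ∀ j, e j = fun g => sqNoise (θ (Fin.natAdd k j)) (2 * ν) (g (Fin.natAdd k j)) / a ^ 2 := by
    intro j
    funext g
    rw [← sqProxy_sub_eq, h0]
    simp [he]
  have hind : iIndepFun e P := by
    have h := iIndepFun_gaussVec θ (2 * ν) (f := fun i x => sqNoise (θ i) (2 * ν) x / a ^ 2)
      fun i => (measurable_sqNoise _ _).div_const _
    have h1 := h.precomp (g := fun j : Fin n => Fin.natAdd k j) (Fin.natAdd_injective n k)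
    convert h1 using 1
    funext j
    exact he' j
  have hem : ∀ j, Measurable (e j) := by
    intro j
    rw [he' j]
    exact ((measurable_sqNoise _ _).comp (measurable_pi_apply _)).div_const _
  have he2 : ∀ j, MemLp (e j) 2 P := by
    intro j
    rw [memLp_two_iff_integrable_sq (hem j).aestronglyMeasurable, he' j]
    simp_rw [div_pow]
    exact (integrable_eval_gaussVec (f := fun x => sqNoise (θ (Fin.natAdd k j)) (2 * ν) x ^ 2)
      (hsq _)).div_const _
  have he0 : ∀ j, ∫ g, e j g ∂P = 0 := by
    intro j
    rw [he' j, integral_div, hP, integral_eval_gaussVec θ (2 * ν) (Fin.natAdd k j)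
      (measurable_sqNoise _ _).aestronglyMeasurable]
    have := integral_sqNoise (θ (Fin.natAdd k j)) (2 * ν).toNNReal
    rw [hcoe] at this
    rw [this, zero_div]
  have heτ : ∀ j, ∫ g, e j g ^ 2 ∂P ≤ 800 * ν ^ 2 := by
    intro j
    rw [he' j]
    simp_rw [div_pow]
    rw [integral_div]
    have h1 := hnoise (Fin.natAdd k j)
    have h2 : 0 ≤ ∫ g, sqNoise (θ (Fin.natAdd k j)) (2 * ν) (g (Fin.natAdd k j)) ^ 2 ∂P :=
      integral_nonneg fun g => sq_nonneg _
    rw [h0] at h1 h2 ⊢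
    refine (div_le_self h2 (one_le_pow₀ ha1)).trans (h1.trans (le_of_eq ?_))
    ring
  choose G hGint hGle hGbd using fun j : Fin n =>
    exists_majorant_sq_avgSup hind hem he2 he0 (by positivity : 0 ≤ 800 * ν ^ 2) heτ j
  set F : (Fin (k + n) → ℝ) → ℝ := fun g => 2 * (k * ν) + 4 * (∑ i : Fin k,
      2 / (θ (Fin.castAdd n i) ^ 2 + ν) *
          sqNoise (θ (Fin.castAdd n i)) (2 * ν) (g (Fin.castAdd n i)) ^ 2 +
        1 / ν * ∑ j : Fin n, G j g) with hF
  have hi1 : ∀ i : Fin k, Integrable (fun g : Fin (k + n) → ℝ => 2 / (θ (Fin.castAdd n i) ^ 2 + ν) *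
      sqNoise (θ (Fin.castAdd n i)) (2 * ν) (g (Fin.castAdd n i)) ^ 2) P := fun i =>
    (integrable_eval_gaussVec (f := fun x => sqNoise (θ (Fin.castAdd n i)) (2 * ν) x ^ 2)
      (hsq _)).const_mul _
  have hi2 : Integrable (fun g => 1 / ν * ∑ j : Fin n, G j g) P :=
    (integrable_finsetSum _ fun j _ => hGint j).const_mul _
  have hi3 : Integrable (fun g : Fin (k + n) → ℝ => ∑ i : Fin k,
      2 / (θ (Fin.castAdd n i) ^ 2 + ν) *
        sqNoise (θ (Fin.castAdd n i)) (2 * ν) (g (Fin.castAdd n i)) ^ 2) P :=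
    integrable_finsetSum _ fun i _ => hi1 i
  have hi4 : Integrable (fun g : Fin (k + n) → ℝ => ∑ i : Fin k,
      2 / (θ (Fin.castAdd n i) ^ 2 + ν) *
        sqNoise (θ (Fin.castAdd n i)) (2 * ν) (g (Fin.castAdd n i)) ^ 2 +
      1 / ν * ∑ j : Fin n, G j g) P := hi3.add hi2
  have hFint : Integrable F P := (integrable_const _).add (hi4.const_mul 4)
  have hG0 : ∀ j g, 0 ≤ G j g := fun j g => (sq_nonneg _).trans (hGle j g)
  have hF0 : ∀ g, 0 ≤ F g := by
    intro g
    have h1 : 0 ≤ ∑ i : Fin k, 2 / (θ (Fin.castAdd n i) ^ 2 + ν) *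
          sqNoise (θ (Fin.castAdd n i)) (2 * ν) (g (Fin.castAdd n i)) ^ 2 :=
      Finset.sum_nonneg fun i _ => by positivity
    have h2 : 0 ≤ ∑ j : Fin n, G j g := Finset.sum_nonneg fun j _ => hG0 j g
    simp only [hF]
    positivity
  have hFbd : ∫ g, F g ∂P ≤ 102400 * ν * (k + ∑ j : Fin n, 1 / ((j : ℝ) + 1)) := by
    have h1 : ∫ g, F g ∂P = 2 * (k * ν) + 4 * (∑ i : Fin k, 2 / (θ (Fin.castAdd n i) ^ 2 + ν) *
          ∫ g, sqNoise (θ (Fin.castAdd n i)) (2 * ν) (g (Fin.castAdd n i)) ^ 2 ∂P +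
        1 / ν * ∑ j : Fin n, ∫ g, G j g ∂P) := by
      simp only [hF]
      rw [integral_add (integrable_const _) (hi4.const_mul 4), integral_const_mul (4 : ℝ),
        integral_add hi3 hi2, integral_const_mul (1 / ν), integral_finsetSum _ fun i _ => hi1 i,
        integral_finsetSum _ fun j _ => hGint j]
      simp_rw [integral_const_mul]
      simp
    have h2 : ∑ i : Fin k, 2 / (θ (Fin.castAdd n i) ^ 2 + ν) *
          ∫ g, sqNoise (θ (Fin.castAdd n i)) (2 * ν) (g (Fin.castAdd n i)) ^ 2 ∂P ≤
        k * (1600 * ν) := by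
      refine (Finset.sum_le_sum (g := fun _ => 1600 * ν) fun i _ => ?_).trans (by simp)
      have h3 := hnoise (Fin.castAdd n i)
      have h4 : 0 < θ (Fin.castAdd n i) ^ 2 + ν := by positivity
      rw [div_mul_eq_mul_div, div_le_iff₀ h4]
      nlinarith [mul_nonneg hν.le (sq_nonneg (θ (Fin.castAdd n i)))]
    have h5 : 1 / ν * ∑ j : Fin n, ∫ g, G j g ∂P ≤
        25600 * ν * ∑ j : Fin n, 1 / ((j : ℝ) + 1) := by
      have h6 : ∑ j : Fin n, ∫ g, G j g ∂P ≤
          ∑ j : Fin n, 25600 * ν ^ 2 * (1 / ((j : ℝ) + 1)) :=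
        Finset.sum_le_sum fun j _ => (hGbd j).trans (le_of_eq (by ring))
      rw [← Finset.mul_sum] at h6
      rw [one_div, inv_mul_le_iff₀ hν]
      refine h6.trans (le_of_eq (by ring))
    rw [h1]
    have h7 : 0 ≤ (k : ℝ) * ν := by positivity
    nlinarith
  calc _ ≤ ∫⁻ g, ENNReal.ofReal (F g) ∂P := by
        refine lintegral_mono fun g => ?_
        dsimp only
        rw [lintegral_sqLoss_shrink _ _ hν.le]
        refine ENNReal.ofReal_le_ofReal
          ((sum_shrink_risk_le hν ha1 ha2 hanti hR hR0 h0 g).trans ?_)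
        have h1 : ∑ j : Fin n, avgSup n (zeroExt fun j => sqProxy a ν g (Fin.natAdd k j)) j ^ 2 ≤
            ∑ j : Fin n, G j g := Finset.sum_le_sum fun j _ => hGle j g
        simp only [hF]
        gcongr
    _ = ENNReal.ofReal (∫ g, F g ∂P) :=
        (ofReal_integral_eq_lintegral_ofReal hFint (ae_of_all _ hF0)).symm
    _ ≤ _ := ENNReal.ofReal_le_ofReal hFbd

/-! ### Independence of the folds -/

/-- The two folds used for the profiles and the clone that is shrunk. -/
def folds {p : ℕ} (ω : (Fin p → ℝ) × (Fin p → ℝ) × (Fin p → ℝ)) :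
    (Fin p → ℝ) × (Fin p → ℝ) × (Fin p → ℝ) :=
  (ω.1 + ω.2.1 + ω.2.2, ω.1 + ω.2.1 - ω.2.2, ω.1 - ω.2.1)

/-- The two folds and the clone are independent, by two successive rotations. -/
theorem measurePreserving_folds {p : ℕ} (lam : ℝ) (θ : Fin p → ℝ) :
    MeasurePreserving folds (jointLaw lam θ) ((gaussVec θ (2 * (2 * lam))).prod
      ((gaussVec θ (2 * (2 * lam))).prod (gaussVec θ (2 * lam)))) := by
  have h1 := (measurePreserving_prodAssoc (gaussVec θ lam) (gaussVec (0 : Fin p → ℝ) lam)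
    (gaussVec (0 : Fin p → ℝ) (2 * lam))).symm
  have h2 := (measurePreserving_add_sub_gaussVec θ 0 lam).prod
    (MeasurePreserving.id (gaussVec (0 : Fin p → ℝ) (2 * lam)))
  have h3 := measurePreserving_prodAssoc (gaussVec (θ + 0) (2 * lam)) (gaussVec (θ - 0) (2 * lam))
    (gaussVec (0 : Fin p → ℝ) (2 * lam))
  have h4 := (MeasurePreserving.id (gaussVec (θ + 0) (2 * lam))).prod
    (Measure.measurePreserving_swap (μ := gaussVec (θ - 0) (2 * lam))
      (ν := gaussVec (0 : Fin p → ℝ) (2 * lam)))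
  have h5 := (measurePreserving_prodAssoc (gaussVec (θ + 0) (2 * lam))
    (gaussVec (0 : Fin p → ℝ) (2 * lam)) (gaussVec (θ - 0) (2 * lam))).symm
  have h6 := (measurePreserving_add_sub_gaussVec (θ + 0) 0 (2 * lam)).prod
    (MeasurePreserving.id (gaussVec (θ - 0) (2 * lam)))
  have h7 := measurePreserving_prodAssoc (gaussVec (θ + 0 + 0) (2 * (2 * lam)))
    (gaussVec (θ + 0 - 0) (2 * (2 * lam))) (gaussVec (θ - 0) (2 * lam))
  have h := h7.comp (h6.comp (h5.comp (h4.comp (h3.comp (h2.comp h1)))))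
  simp only [add_zero, sub_zero] at h
  exact h

theorem pilot_eq_profile {p : ℕ} (a R ν : ℝ) (yp z' : Fin p → ℝ) :
    pilot a R ν yp z' = profile a R ν (fun _ => 1) (yp + z') := by
  funext i
  have h : proxy a ν 1 yp z' = sqProxy a ν (yp + z') := by
    funext j
    simp [proxy, sqProxy]
  simp only [pilot, profile, h]

theorem Vhat_eq_profile {p : ℕ} (a R ν : ℝ) (yp z' : Fin p → ℝ) :
    Vhat a R ν yp z' = profile a R ν (binWeight R ν (pilot a R ν yp z')) (yp - z') := by
  funext i
  have h : proxy a ν (-1) yp z' = sqProxy a ν (yp - z') := by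
    funext j
    simp [proxy, sqProxy, sub_eq_add_neg]
  simp only [Vhat, profile, h]

/-- The binning event in terms of the pilot fold alone. -/
def pilotEvent {p : ℕ} (a R ν : ℝ) (θ : Fin p → ℝ) : Set (Fin p → ℝ) :=
  {g | ∀ m < numBins R ν, ∀ i ∈ bin ν (profile a R ν (fun _ => 1) g) m,
    i ∈ bin ν (fun i => θ i ^ 2) m}

theorem eventB1_eq_preimage {p : ℕ} (a R ν : ℝ) (θ : Fin p → ℝ) :
    eventB1 a R ν θ = folds ⁻¹' (pilotEvent a R ν θ ×ˢ Set.univ) := by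
  ext ω
  simp only [eventB1, pilot_eq_profile, folds, pilotEvent, Set.mem_preimage, Set.mem_prod,
    Set.mem_univ, and_true, Set.mem_ofPred_eq]
  rfl

theorem measurableSet_pilotEvent {p : ℕ} (a R ν : ℝ) (θ : Fin p → ℝ) :
    MeasurableSet (pilotEvent a R ν θ) := by
  have hcont := fun i => (continuous_profile (p := p) a R ν (w := fun _ => 1)
    (fun _ => one_pos) i).measurable
  have h : pilotEvent a R ν θ = ⋂ m : ℕ, ⋂ _ : m < numBins R ν, ⋂ i : Fin p,
      ({g | i ∈ bin ν (profile a R ν (fun _ => 1) g) m}ᶜ ∪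
        {_g | i ∈ bin ν (fun i => θ i ^ 2) m}) := by
    ext g
    simp only [pilotEvent, Set.mem_ofPred_eq, Set.mem_iInter, Set.mem_union, Set.mem_compl_iff]
    exact forall_congr' fun m => forall_congr' fun _ => forall_congr' fun i => imp_iff_not_or
  rw [h]
  refine MeasurableSet.iInter fun m => MeasurableSet.iInter fun _ => MeasurableSet.iInter fun i =>
    MeasurableSet.union (MeasurableSet.compl ?_) (MeasurableSet.const _)
  exact (measurableSet_le measurable_const ((hcont i).add_const _)).inter
    (measurableSet_lt ((hcont i).add_const _) measurable_const)

/-- On the binning event the data-driven weights are the oracle weights. -/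
theorem thetaHat_eq_of_mem_eventB1 {p : ℕ} {a R ν : ℝ} (hν : 0 < ν) (hR : 0 ≤ R) {θ : Fin p → ℝ}
    {ω : (Fin p → ℝ) × (Fin p → ℝ) × (Fin p → ℝ)} (hω : ω ∈ eventB1 a R ν θ) :
    thetaHat a R ν ω.1 ω.2.1 ω.2.2 = fun i =>
      shrinkage a R ν (binWeight R ν fun i => θ i ^ 2) (folds ω).2.1 i * (folds ω).2.2 i := by
  have hw : binWeight R ν (pilot a R ν (ω.1 + ω.2.1) ω.2.2) = binWeight R ν fun i => θ i ^ 2 := by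
    refine binWeight_congr hν (fun i => ?_) (fun i => min_le_right _ _) hω
    rw [pilot_eq_profile]
    exact profile_nonneg hR (fun _ => one_pos) _ _
  funext i
  simp only [thetaHat, Vhat_eq_profile, hw, shrinkage, folds, Pi.sub_apply]

/-- Conditionally on the binning event, the estimator has at most the risk of its version with
oracle weights: the event depends on the pilot fold only, which is independent of everything
else. -/
theorem condRisk_le_oracleRisk {p : ℕ} {a R lam : ℝ} (hlam : 0 < lam) (hR : 0 ≤ R)
    {θ : Fin p → ℝ} (hθ : ∀ i, θ i ^ 2 ≤ R) :
    condRisk a R lam θ ≤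
      ∫⁻ g, ∫⁻ x, sqLoss (fun i =>
        shrinkage a R (2 * lam) (binWeight R (2 * lam) fun i => θ i ^ 2) g i * x i) θ
        ∂gaussVec θ (2 * lam) ∂gaussVec θ (2 * (2 * lam)) := by
  have hν : 0 < 2 * lam := by linarith
  set ν := 2 * lam with hνdef
  set w := binWeight R ν fun i => θ i ^ 2 with hwdef
  have hw : ∀ i, 0 < w i := binWeight_pos hν (fun i => sq_nonneg _) hθ
  set Q := gaussVec θ (2 * ν) with hQ
  set Q' := gaussVec θ ν with hQ'
  set B := pilotEvent a R ν θ with hB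
  have hBm : MeasurableSet B := measurableSet_pilotEvent a R ν θ
  have hfolds : MeasurePreserving folds (jointLaw lam θ) (Q.prod (Q.prod Q')) :=
    measurePreserving_folds lam θ
  have hEm : MeasurableSet (eventB1 a R ν θ) := by
    rw [eventB1_eq_preimage]
    exact hfolds.measurable (hBm.prod MeasurableSet.univ)
  set F : (Fin p → ℝ) × (Fin p → ℝ) → ℝ≥0∞ :=
    fun z => sqLoss (fun i => shrinkage a R ν w z.1 i * z.2 i) θ with hF
  have hFm : Measurable F := by
    simp only [hF, sqLoss]
    refine ENNReal.measurable_ofReal.comp (Finset.measurable_fun_sum _ fun i _ => ?_)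
    have := (continuous_shrinkage (a := a) hν hR hw i).measurable
    fun_prop
  have h1 : ∫⁻ ω in eventB1 a R ν θ, sqLoss (thetaHat a R ν ω.1 ω.2.1 ω.2.2) θ ∂jointLaw lam θ =
      Q B * ∫⁻ z, F z ∂Q.prod Q' := by
    rw [setLIntegral_congr_fun (g := fun ω => F (folds ω).2) hEm fun ω hω => by
      dsimp only
      rw [thetaHat_eq_of_mem_eventB1 hν hR hω], eventB1_eq_preimage]
    rw [hfolds.setLIntegral_comp_preimage (hBm.prod MeasurableSet.univ) (f := fun z => F z.2)
      (hFm.comp measurable_snd), ← Measure.prod_restrict, Measure.restrict_univ,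
      lintegral_prod (fun z => F z.2) (hFm.comp measurable_snd).aemeasurable]
    simp [mul_comm]
  have h2 : jointLaw lam θ (eventB1 a R ν θ) = Q B := by
    rw [eventB1_eq_preimage, hfolds.measure_preimage
      (hBm.prod MeasurableSet.univ).nullMeasurableSet, Measure.prod_prod]
    simp
  rw [← lintegral_prod (μ := Q) (ν := Q') F hFm.aemeasurable]
  unfold condRisk riskUnder ProbabilityTheory.cond
  rw [lintegral_smul_measure, h1, h2, smul_eq_mul, ← mul_assoc]
  exact mul_le_of_le_one_left' (ENNReal.inv_mul_le_one _)

/-- The binning event has positive probability: it contains all data for which the pilot proxies are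
close to the signal strengths shifted upwards by a small amount. -/
theorem measure_eventB1_ne_zero {p : ℕ} {a R lam : ℝ} (ha : 0 < a) (hlam : 0 < lam)
    {θ : Fin p → ℝ} (hanti : Antitone fun i => θ i ^ 2) (hθ : ∀ i, θ i ^ 2 ≤ R) :
    jointLaw lam θ (eventB1 a R (2 * lam) θ) ≠ 0 := by
  have hν : 0 < 2 * lam := by linarith
  set ν := 2 * lam with hνdef
  set Q := gaussVec θ (2 * ν) with hQ
  have hBm := measurableSet_pilotEvent a R ν θ
  have hfolds : MeasurePreserving folds (jointLaw lam θ) (Q.prod (Q.prod (gaussVec θ ν))) :=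
    measurePreserving_folds lam θ
  have h2 : jointLaw lam θ (eventB1 a R ν θ) = Q (pilotEvent a R ν θ) := by
    rw [eventB1_eq_preimage, hfolds.measure_preimage
      (hBm.prod MeasurableSet.univ).nullMeasurableSet, Measure.prod_prod]
    simp
  rw [h2]
  choose m hmM hm using fun i => exists_mem_bin hν (u := fun i => θ i ^ 2)
    (fun i => sq_nonneg _) hθ i
  obtain ⟨δ, hδ0, hδ⟩ : ∃ δ : ℝ, 0 < δ ∧ ∀ i, θ i ^ 2 + 2 * δ + ν < thr ν (m i + 1) := by
    have hev : ∀ᶠ δ in nhdsWithin (0 : ℝ) (Set.Ioi 0),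
        ∀ i, θ i ^ 2 + 2 * δ + ν < thr ν (m i + 1) := by
      rw [Filter.eventually_all]
      intro i
      refine Filter.Eventually.filter_mono nhdsWithin_le_nhds ?_
      have hc : Continuous fun δ : ℝ => θ i ^ 2 + 2 * δ + ν := by fun_prop
      refine hc.continuousAt.eventually_lt continuousAt_const ?_
      simpa using (hm i).2
    obtain ⟨δ, h, h'⟩ := (hev.and self_mem_nhdsWithin).exists
    exact ⟨δ, h', h⟩
  set x₀ : Fin p → ℝ := fun i => θ i ^ 2 + δ with hx₀
  have hx₀cone : x₀ ∈ isoCone p :=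
    ⟨fun i j hij => add_le_add_left (hanti hij) δ, fun i => by positivity⟩
  set O : Set (Fin p → ℝ) := {g | ∑ i, (sqProxy a ν g i - x₀ i) ^ 2 < δ ^ 2} with hO
  have hOopen : IsOpen O := by
    have hc := continuous_sqProxy (p := p) a ν
    refine isOpen_lt (continuous_finsetSum _ fun i _ => ?_) continuous_const
    exact (((continuous_apply i).comp hc).sub continuous_const).pow 2
  have hOne : O.Nonempty := by
    refine ⟨fun i => a * Real.sqrt (x₀ i + 2 * ν / a ^ 2), ?_⟩
    have hz : ∀ i, sqProxy a ν (fun i => a * Real.sqrt (x₀ i + 2 * ν / a ^ 2)) i - x₀ i = 0 := by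
      intro i
      unfold sqProxy
      have hpos : 0 ≤ x₀ i + 2 * ν / a ^ 2 := add_nonneg (hx₀cone.2 i) (by positivity)
      rw [mul_div_cancel_left₀ _ ha.ne', Real.sq_sqrt hpos]
      ring
    simp only [hO, Set.mem_ofPred_eq, hz]
    simpa using pow_pos hδ0 2
  have hsub : O ⊆ pilotEvent a R ν θ := by
    intro g hg m' _ i hi
    have hfit := (isIsoFit_isoFit (fun _ : Fin p => (1 : ℝ)) (sqProxy a ν g)
      fun _ => one_pos).sum_sq_sub_le (fun _ => one_pos) (isIsoFit_self (fun _ => one_pos) hx₀cone)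
    simp only [one_mul] at hfit
    set v := isoFit (fun _ : Fin p => (1 : ℝ)) (sqProxy a ν g) with hv
    have h3 : (v i - x₀ i) ^ 2 < δ ^ 2 :=
      ((Finset.single_le_sum (f := fun i => (v i - x₀ i) ^ 2) (fun j _ => sq_nonneg _)
        (Finset.mem_univ i)).trans hfit).trans_lt hg
    have h4 := abs_lt_of_sq_lt_sq h3 hδ0.le
    rw [abs_lt] at h4
    have h5 : i ∈ bin ν (profile a R ν (fun _ => 1) g) (m i) := by
      have h6 : θ i ^ 2 ≤ profile a R ν (fun _ => 1) g i :=
        le_min (by simp only [hx₀] at h4; linarith [h4.1]) (hθ i)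
      have h7 : profile a R ν (fun _ => 1) g i ≤ θ i ^ 2 + 2 * δ :=
        (min_le_left _ _).trans (by simp only [hx₀] at h4; linarith [h4.2])
      exact ⟨(hm i).1.trans (by dsimp only; linarith), by linarith [hδ i]⟩
    rw [bin_unique hν hi h5]
    exact hm i
  have : Q.IsOpenPosMeasure := isOpenPosMeasure_gaussVec θ (by linarith)
  exact fun h => (hOopen.measure_ne_zero Q hOne) (measure_mono_null hsub h)

/-! ### The sparse class -/

/-- Membership in the class, with the length of the support at most the dimension. -/
theorem exists_support_of_mem_sparseClass {p s : ℕ} {R : ℝ} (hs : s ≤ p) {θ : Fin p → ℝ}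
    (hθ : θ ∈ sparseClass p s R) :
    ∃ k ≤ s, k ≤ p ∧ (Antitone fun i => θ i ^ 2) ∧ (∀ i, θ i ^ 2 ≤ R) ∧
      ∀ i : Fin p, k ≤ (i : ℕ) → θ i = 0 := by
  obtain ⟨k, hk, hanti, hR, h0⟩ := hθ
  have hA : Antitone fun i => θ i ^ 2 := by
    intro i j hij
    rcases Nat.lt_or_ge (j : ℕ) k with h | h
    · exact hanti i j hij h
    · change θ j ^ 2 ≤ θ i ^ 2
      rw [h0 j h]
      simpa using sq_nonneg (θ i)
  refine ⟨k, hk, hk.trans hs, hA, fun i => ?_, h0⟩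
  have hp : 0 < p := i.pos
  exact (hA (Fin.mk_le_of_le_val (Nat.zero_le i) : (⟨0, hp⟩ : Fin p) ≤ i)).trans (hR _ rfl)

theorem one_add_log_le {p s : ℝ} (hs : 1 ≤ s) (hsp : s ≤ p) :
    1 + Real.log p ≤ s * Real.log (Real.exp 1 * p / s) ∧
      1 ≤ Real.log (Real.exp 1 * p / s) := by
  have hs0 : 0 < s := by linarith
  have hp0 : 0 < p := by linarith
  have hlog : Real.log (Real.exp 1 * p / s) = 1 + Real.log p - Real.log s := by
    rw [Real.log_div (by positivity) hs0.ne', Real.log_mul (by positivity) hp0.ne', Real.log_exp]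
  have h1 := Real.log_le_log hs0 hsp
  have h2 := Real.log_le_sub_one_of_pos hs0
  have h3 := Real.log_nonneg hs
  rw [hlog]
  constructor
  · nlinarith
  · linarith

theorem sum_one_div_le (q : ℕ) : ∑ j : Fin q, 1 / ((j : ℝ) + 1) ≤ 1 + Real.log q := by
  have h := harmonic_le_one_add_log q
  unfold harmonic at h
  rw [← Finset.sum_range fun j : ℕ => 1 / ((j : ℝ) + 1)]
  push_cast at h
  simpa using h

/-- The conditional risk bound, without the factor `log (1 + R / lam)`. -/
theorem condRisk_le {p s : ℕ} {a R lam : ℝ} (hs : 1 ≤ s) (hsp : s ≤ p) (hlam : 0 < lam)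
    (hR : 0 ≤ R) (ha1 : 1 ≤ a ^ 2) (ha2 : a ^ 2 ≤ 2) {θ : Fin p → ℝ}
    (hθ : θ ∈ sparseClass p s R) :
    condRisk a R lam θ ≤
      ENNReal.ofReal (409600 * (s * lam * Real.log (Real.exp 1 * p / s))) := by
  obtain ⟨k, hks, hkp, hanti, hθR, h0⟩ := exists_support_of_mem_sparseClass hsp hθ
  refine (condRisk_le_oracleRisk hlam hR hθR).trans ?_
  obtain ⟨q, rfl⟩ := Nat.exists_eq_add_of_le hkp
  refine (oracleRisk_le (by linarith) ha1 ha2 hanti hθR hR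
    fun j => h0 _ (by simp)).trans (ENNReal.ofReal_le_ofReal ?_)
  have hs' : (1 : ℝ) ≤ s := by exact_mod_cast hs
  have hsp' : (s : ℝ) ≤ ((k + q : ℕ) : ℝ) := by exact_mod_cast hsp
  have hks' : (k : ℝ) ≤ s := by exact_mod_cast hks
  obtain ⟨hL, hL1⟩ := one_add_log_le hs' hsp'
  set L := Real.log (Real.exp 1 * ((k + q : ℕ) : ℝ) / s)
  have hq : Real.log q ≤ Real.log ((k + q : ℕ) : ℝ) := by
    rcases Nat.eq_zero_or_pos q with rfl | hq0
    · simp only [Nat.cast_zero, Real.log_zero]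
      exact Real.log_natCast_nonneg _
    · refine Real.log_le_log (by exact_mod_cast hq0) ?_
      push_cast
      linarith [(Nat.cast_nonneg k : (0 : ℝ) ≤ k)]
  have h1 := sum_one_div_le q
  have h2 : (k : ℝ) + ∑ j : Fin q, 1 / ((j : ℝ) + 1) ≤ 2 * (s * L) := by nlinarith
  calc 102400 * (2 * lam) * ((k : ℝ) + ∑ j : Fin q, 1 / ((j : ℝ) + 1))
      ≤ 102400 * (2 * lam) * (2 * (s * L)) := by gcongr
    _ = _ := by ring

theorem card_filter_val_lt {p s : ℕ} (hs : s ≤ p) :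
    (Finset.univ.filter fun i : Fin p => (i : ℕ) < s).card = s := by
  rw [Fin.card_filter_val_lt, min_eq_right hs]

/-! ### The minimax lower bound -/

/-- The mass of the common minorant of two Gaussians whose means are one standard deviation to
either side of the origin. -/
noncomputable def overlap : ℝ := Real.exp (-1) / Real.sqrt 2

theorem overlap_pos : 0 < overlap := by unfold overlap; positivity

/-- The Gaussians `N(±√v, v)` dominate a common multiple of `N(0, v / 2)`. -/
theorem smul_gaussianReal_le {v b : ℝ} (hv : 0 < v) (hb : b ^ 2 = v) :
    ENNReal.ofReal overlap • gaussianReal 0 (v / 2).toNNReal ≤ gaussianReal b v.toNNReal := by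
  have hv2 : 0 < v / 2 := by linarith
  have hc1 : (v.toNNReal : ℝ) = v := Real.coe_toNNReal _ hv.le
  have hc2 : ((v / 2).toNNReal : ℝ) = v / 2 := Real.coe_toNNReal _ hv2.le
  rw [gaussianReal_of_var_ne_zero _ (Real.toNNReal_pos.mpr hv).ne',
    gaussianReal_of_var_ne_zero _ (Real.toNNReal_pos.mpr hv2).ne',
    ← withDensity_smul _ (measurable_gaussianPDF _ _)]
  refine withDensity_mono (ae_of_all _ fun x => ?_)
  rw [Pi.smul_apply, smul_eq_mul, gaussianPDF, gaussianPDF, ← ENNReal.ofReal_mul overlap_pos.le]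
  refine ENNReal.ofReal_le_ofReal ?_
  unfold gaussianPDFReal overlap
  rw [hc1, hc2]
  have hsqrt : Real.sqrt (2 * Real.pi * v) =
      Real.sqrt 2 * Real.sqrt (2 * Real.pi * (v / 2)) := by
    rw [← Real.sqrt_mul zero_le_two]
    congr 1
    ring
  have hexp : Real.exp (-1) * Real.exp (-(x - 0) ^ 2 / (2 * (v / 2))) ≤
      Real.exp (-(x - b) ^ 2 / (2 * v)) := by
    rw [← Real.exp_add]
    refine Real.exp_le_exp.mpr ?_
    rw [le_div_iff₀ (by positivity)]
    have h : (-1 + -(x - 0) ^ 2 / (2 * (v / 2))) * (2 * v) = -2 * v - 2 * x ^ 2 := by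
      field_simp
      ring
    rw [h, ← hb]
    nlinarith [sq_nonneg (x + b)]
  have hpos : 0 < Real.sqrt (2 * Real.pi * (v / 2)) := by
    have := Real.pi_pos
    positivity
  rw [hsqrt, mul_inv]
  calc Real.exp (-1) / Real.sqrt 2 * ((Real.sqrt (2 * Real.pi * (v / 2)))⁻¹ *
        Real.exp (-(x - 0) ^ 2 / (2 * (v / 2))))
      = (Real.sqrt 2)⁻¹ * (Real.sqrt (2 * Real.pi * (v / 2)))⁻¹ *
        (Real.exp (-1) * Real.exp (-(x - 0) ^ 2 / (2 * (v / 2)))) := by ring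
    _ ≤ _ := by gcongr

/-- A product measure is monotone in each single factor. -/
theorem pi_le_pi {p : ℕ} {μ μ' : Fin p → Measure ℝ} [∀ i, SigmaFinite (μ i)]
    [∀ i, SigmaFinite (μ' i)] (i : Fin p) (h : ∀ j ≠ i, μ' j = μ j) (hi : μ' i ≤ μ i) :
    Measure.pi μ' ≤ Measure.pi μ := by
  refine Measure.le_iff.mpr fun s hs => ?_
  have hf : Measurable (s.indicator (1 : (Fin p → ℝ) → ℝ≥0∞)) := measurable_one.indicator hs
  rw [← lintegral_indicator_one hs, ← lintegral_indicator_one hs,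
    lintegral_eq_lmarginal_univ (μ := μ') 0, lintegral_eq_lmarginal_univ (μ := μ) 0,
    lmarginal_erase (μ := μ') _ hf (Finset.mem_univ i),
    lmarginal_erase (μ := μ) _ hf (Finset.mem_univ i)]
  have hrest : lmarginal μ' (Finset.univ.erase i) (s.indicator (1 : (Fin p → ℝ) → ℝ≥0∞)) =
      lmarginal μ (Finset.univ.erase i) (s.indicator 1) := by
    have : (fun j : ↥(Finset.univ.erase i : Finset (Fin p)) => μ' j.1) = fun j => μ j.1 :=
      funext fun j => h j.1 (Finset.ne_of_mem_erase j.2)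
    unfold lmarginal
    rw [this]
  rw [hrest]
  exact lintegral_mono' hi le_rfl

/-- The expected squared error of a randomized estimator in one coordinate. -/
noncomputable def coordRisk {p : ℕ} (δ : Kernel (Fin p → ℝ) (Fin p → ℝ)) (lam : ℝ)
    (θ : Fin p → ℝ) (i : Fin p) : ℝ≥0∞ :=
  ∫⁻ y, ∫⁻ u, ENNReal.ofReal ((u i - θ i) ^ 2) ∂(δ y) ∂(gaussVec θ lam)

/-- Le Cam's two point bound: an estimator cannot do well in coordinate `i` at both of two
parameters that differ only by the sign of `θ_i = ±√lam`. -/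
theorem le_coordRisk_add {p : ℕ} (δ : Kernel (Fin p → ℝ) (Fin p → ℝ)) [IsMarkovKernel δ]
    {lam : ℝ} (hlam : 0 < lam) {θ θ' : Fin p → ℝ} {i : Fin p} (hi : θ i ^ 2 = lam)
    (hi' : θ' i = -θ i) (h : ∀ j ≠ i, θ' j = θ j) :
    2 * ENNReal.ofReal (overlap * lam) ≤ coordRisk δ lam θ i + coordRisk δ lam θ' i := by
  classical
  set μ' : Fin p → Measure ℝ := fun j => if j = i then
    ENNReal.ofReal overlap • gaussianReal 0 (lam / 2).toNNReal
    else gaussianReal (θ j) lam.toNNReal with hμ'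
  have hfin : ∀ j, IsFiniteMeasure (μ' j) := by
    intro j
    simp only [hμ']
    split_ifs
    · exact Measure.smul_finite _ ENNReal.ofReal_ne_top
    · infer_instance
  set Q := Measure.pi μ' with hQ
  have hQuniv : Q Set.univ = ENNReal.ofReal overlap := by
    rw [hQ, Measure.pi_univ, Finset.prod_eq_single i]
    · simp [hμ']
    · intro j _ hj
      simp [hμ', hj]
    · simp
  have hQθ : Q ≤ gaussVec θ lam :=
    pi_le_pi i (fun j hj => by simp [hμ', hj])
      (by simpa [hμ'] using smul_gaussianReal_le hlam hi)
  have hQθ' : Q ≤ gaussVec θ' lam :=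
    pi_le_pi i (fun j hj => by simp [hμ', hj, h j hj])
      (by
        have : θ' i ^ 2 = lam := by rw [hi', neg_sq, hi]
        simpa [hμ'] using smul_gaussianReal_le hlam this)
  have hm : ∀ t : ℝ, Measurable fun u : Fin p → ℝ => ENNReal.ofReal ((u i - t) ^ 2) := fun t => by
    fun_prop
  have hpt : ∀ y, ENNReal.ofReal (2 * lam) ≤
      ∫⁻ u, ENNReal.ofReal ((u i - θ i) ^ 2) ∂(δ y) +
      ∫⁻ u, ENNReal.ofReal ((u i - θ' i) ^ 2) ∂(δ y) := by
    intro y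
    rw [← lintegral_add_left (hm _)]
    calc ENNReal.ofReal (2 * lam) = ∫⁻ _, ENNReal.ofReal (2 * lam) ∂(δ y) := by simp
      _ ≤ _ := by
        refine lintegral_mono fun u => ?_
        dsimp only
        rw [← ENNReal.ofReal_add (sq_nonneg _) (sq_nonneg _), hi']
        refine ENNReal.ofReal_le_ofReal ?_
        nlinarith [sq_nonneg (u i)]
  calc 2 * ENNReal.ofReal (overlap * lam) = ENNReal.ofReal (2 * lam) * Q Set.univ := by
        rw [hQuniv, ← ENNReal.ofReal_mul (by positivity), ← ENNReal.ofReal_ofNat 2,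
          ← ENNReal.ofReal_mul zero_le_two]
        congr 1
        ring
    _ = ∫⁻ _, ENNReal.ofReal (2 * lam) ∂Q := by simp
    _ ≤ ∫⁻ y, (∫⁻ u, ENNReal.ofReal ((u i - θ i) ^ 2) ∂(δ y) +
          ∫⁻ u, ENNReal.ofReal ((u i - θ' i) ^ 2) ∂(δ y)) ∂Q := lintegral_mono hpt
    _ = ∫⁻ y, ∫⁻ u, ENNReal.ofReal ((u i - θ i) ^ 2) ∂(δ y) ∂Q +
          ∫⁻ y, ∫⁻ u, ENNReal.ofReal ((u i - θ' i) ^ 2) ∂(δ y) ∂Q :=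
        lintegral_add_left ((hm _).lintegral_kernel) _
    _ ≤ _ := add_le_add (lintegral_mono' hQθ le_rfl) (lintegral_mono' hQθ' le_rfl)

/-- The vertex of the hypercube `{±√lam}^s × {0}` with the given signs. -/
noncomputable def vertex {p : ℕ} (s : ℕ) (lam : ℝ) (ε : Fin p → Bool) (i : Fin p) : ℝ :=
  if (i : ℕ) < s then (if ε i then Real.sqrt lam else -Real.sqrt lam) else 0

theorem vertex_sq {p s : ℕ} {lam : ℝ} (hlam : 0 ≤ lam) (ε : Fin p → Bool) {i : Fin p}
    (hi : (i : ℕ) < s) : vertex s lam ε i ^ 2 = lam := by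
  unfold vertex
  rw [if_pos hi]
  split_ifs <;> simp [Real.sq_sqrt hlam]

theorem vertex_mem_sparseClass {p s : ℕ} {lam R : ℝ} (hs : 1 ≤ s) (hlam : 0 ≤ lam)
    (hR : lam ≤ R) (ε : Fin p → Bool) : vertex s lam ε ∈ sparseClass p s R := by
  refine ⟨s, le_rfl, fun i j hij hj => ?_, fun i hi => ?_, fun i hi => ?_⟩
  · rw [vertex_sq hlam ε hj, vertex_sq hlam ε (lt_of_le_of_lt (by exact_mod_cast hij) hj)]
  · rw [vertex_sq hlam ε (by omega)]
    exact hR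
  · simp [vertex, not_lt.mpr hi]

/-- Assouad's lemma on the hypercube of vertices: averaging over all sign patterns reduces the
minimax risk to two point problems in single coordinates. -/
theorem le_minimaxRisk {p s : ℕ} {lam R : ℝ} (hs : 1 ≤ s) (hsp : s ≤ p) (hlam : 0 < lam)
    (hR : lam ≤ R) : ENNReal.ofReal (overlap * (s * lam)) ≤ minimaxRisk p s R lam := by
  classical
  refine le_iInf₂ fun δ hδ => ?_
  set S := ⨆ θ ∈ sparseClass p s R, ∫⁻ y, ∫⁻ u, sqLoss u θ ∂(δ y) ∂(gaussVec θ lam) with hS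
  set A : Finset (Fin p) := Finset.univ.filter fun i => (i : ℕ) < s with hA
  set K := ENNReal.ofReal (overlap * lam) with hK
  set N : ℝ≥0∞ := ((Fintype.card (Fin p → Bool) : ℕ) : ℝ≥0∞) with hN
  have hrisk : ∀ ε : Fin p → Bool, ∑ i ∈ A, coordRisk δ lam (vertex s lam ε) i ≤ S := by
    intro ε
    have h1 : ∫⁻ y, ∫⁻ u, sqLoss u (vertex s lam ε) ∂(δ y) ∂(gaussVec (vertex s lam ε) lam) ≤ S :=
      le_iSup₂ (f := fun θ (_ : θ ∈ sparseClass p s R) =>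
        ∫⁻ y, ∫⁻ u, sqLoss u θ ∂(δ y) ∂(gaussVec θ lam)) _
        (vertex_mem_sparseClass hs hlam.le hR ε)
    refine le_trans (le_trans (b := ∑ i, coordRisk δ lam (vertex s lam ε) i) ?_
      (le_of_eq ?_)) h1
    · exact Finset.sum_le_sum_of_subset (Finset.subset_univ A)
    · have hm : ∀ i : Fin p, Measurable fun u : Fin p → ℝ =>
          ENNReal.ofReal ((u i - vertex s lam ε i) ^ 2) := fun i => by fun_prop
      unfold coordRisk sqLoss
      rw [← lintegral_finsetSum _ fun i _ => (hm i).lintegral_kernel]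
      refine lintegral_congr fun y => ?_
      rw [← lintegral_finsetSum _ fun i _ => hm i]
      refine lintegral_congr fun u => ?_
      rw [ENNReal.ofReal_sum_of_nonneg fun i _ => sq_nonneg _]
  have hflip : ∀ i ∈ A, N * K ≤ ∑ ε : Fin p → Bool, coordRisk δ lam (vertex s lam ε) i := by
    intro i hi
    have his : (i : ℕ) < s := (Finset.mem_filter.mp hi).2
    set f : (Fin p → Bool) → Fin p → Bool := fun ε => Function.update ε i (!ε i) with hf
    have hinv : Function.Involutive f := by
      intro ε
      simp [hf]
    have h1 : ∑ ε : Fin p → Bool, coordRisk δ lam (vertex s lam (f ε)) i =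
        ∑ ε : Fin p → Bool, coordRisk δ lam (vertex s lam ε) i :=
      Equiv.sum_comp hinv.toPerm fun ε => coordRisk δ lam (vertex s lam ε) i
    have h2 : ∑ _ε : Fin p → Bool, 2 * K ≤ ∑ ε : Fin p → Bool,
        (coordRisk δ lam (vertex s lam ε) i + coordRisk δ lam (vertex s lam (f ε)) i) := by
      refine Finset.sum_le_sum fun ε _ => ?_
      refine le_coordRisk_add δ hlam (vertex_sq hlam.le ε his) ?_ fun j hj => ?_
      · simp only [vertex, his, if_true, hf, Function.update_self]
        cases ε i <;> simp
      · simp [vertex, hf, Function.update_of_ne hj]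
    rw [Finset.sum_add_distrib, h1, ← two_mul, Finset.sum_const, nsmul_eq_mul, Finset.card_univ,
      ← mul_assoc, mul_comm _ (2 : ℝ≥0∞), mul_assoc] at h2
    exact (ENNReal.mul_le_mul_iff_right two_ne_zero ENNReal.ofNat_ne_top).mp h2
  have hN0 : N ≠ 0 := by
    rw [hN]
    exact_mod_cast Fintype.card_ne_zero
  have hNtop : N ≠ ∞ := ENNReal.natCast_ne_top _
  have htotal : N * (s * K) ≤ N * S := by
    calc N * (s * K) = ∑ _i ∈ A, N * K := by
          rw [Finset.sum_const, hA, card_filter_val_lt hsp, nsmul_eq_mul]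
          ring
      _ ≤ ∑ i ∈ A, ∑ ε : Fin p → Bool, coordRisk δ lam (vertex s lam ε) i :=
          Finset.sum_le_sum hflip
      _ = ∑ ε : Fin p → Bool, ∑ i ∈ A, coordRisk δ lam (vertex s lam ε) i := Finset.sum_comm
      _ ≤ ∑ _ε : Fin p → Bool, S := Finset.sum_le_sum fun ε _ => hrisk ε
      _ = N * S := by rw [Finset.sum_const, nsmul_eq_mul, Finset.card_univ]
  refine le_trans (le_of_eq ?_) ((ENNReal.mul_le_mul_iff_right hN0 hNtop).mp htotal)
  rw [hK, ← ENNReal.ofReal_natCast, ← ENNReal.ofReal_mul (Nat.cast_nonneg s)]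
  congr 1
  ring

/-! ### The unconditional risk -/

/-- Shrinkage by factors in `[0, 1]` never costs more than the noise level and the signal. -/
theorem risk_le_sum {p : ℕ} {a R lam : ℝ} (hlam : 0 < lam) (hR : 0 ≤ R) (θ : Fin p → ℝ) :
    risk a R lam θ ≤ ENNReal.ofReal (∑ i, (2 * (2 * lam) + 2 * θ i ^ 2)) := by
  have hν : 0 < 2 * lam := by linarith
  set ν := 2 * lam with hνdef
  set G : (Fin p → ℝ) → ℝ := fun x => ∑ i, (2 * (x i - θ i) ^ 2 + 2 * θ i ^ 2) with hG
  have hGm : Measurable fun x => ENNReal.ofReal (G x) := by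
    simp only [hG]
    fun_prop
  have hpt : ∀ ω : (Fin p → ℝ) × (Fin p → ℝ) × (Fin p → ℝ),
      sqLoss (thetaHat a R ν ω.1 ω.2.1 ω.2.2) θ ≤ ENNReal.ofReal (G (folds ω).2.2) := by
    intro ω
    refine ENNReal.ofReal_le_ofReal (Finset.sum_le_sum fun i _ => ?_)
    have hw : ∀ i, 0 < binWeight R ν (pilot a R ν (ω.1 + ω.2.1) ω.2.2) i := by
      refine binWeight_pos hν (fun i => ?_) fun i => min_le_right _ _
      rw [pilot_eq_profile]
      exact profile_nonneg hR (fun _ => one_pos) _ _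
    have hV : 0 ≤ Vhat a R ν (ω.1 + ω.2.1) ω.2.2 i := by
      rw [Vhat_eq_profile]
      exact profile_nonneg hR hw _ _
    set c := Vhat a R ν (ω.1 + ω.2.1) ω.2.2 i / (Vhat a R ν (ω.1 + ω.2.1) ω.2.2 i + ν) with hc
    have hc0 : 0 ≤ c := by positivity
    have hc1 : c ≤ 1 := by
      rw [hc, div_le_one (by positivity)]
      linarith
    have h1 : thetaHat a R ν ω.1 ω.2.1 ω.2.2 i = c * (ω.1 i - ω.2.1 i) := rfl
    have h2 : (folds ω).2.2 i = ω.1 i - ω.2.1 i := rfl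
    rw [h1, h2]
    set x := ω.1 i - ω.2.1 i
    have h3 : (c * x - θ i) ^ 2 ≤ 2 * (c ^ 2 * (x - θ i) ^ 2) + 2 * ((1 - c) ^ 2 * θ i ^ 2) := by
      nlinarith [sq_nonneg (c * (x - θ i) + (1 - c) * θ i)]
    have h4 : c ^ 2 * (x - θ i) ^ 2 ≤ (x - θ i) ^ 2 :=
      mul_le_of_le_one_left (sq_nonneg _) (pow_le_one₀ hc0 hc1)
    have h5 : (1 - c) ^ 2 * θ i ^ 2 ≤ θ i ^ 2 :=
      mul_le_of_le_one_left (sq_nonneg _) (pow_le_one₀ (by linarith) (by linarith))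
    linarith
  have hmp : MeasurePreserving (fun ω => (folds ω).2.2) (jointLaw lam θ) (gaussVec θ ν) :=
    measurePreserving_snd.comp (measurePreserving_snd.comp (measurePreserving_folds lam θ))
  have hcoord : ∀ i, Integrable (fun x : Fin p → ℝ => (x i - θ i) ^ 2) (gaussVec θ ν) := fun i =>
    integrable_eval_gaussVec (f := fun x => (x - θ i) ^ 2) (integrable_pow_gaussianReal _ _ 2)
  have hterm : ∀ i, Integrable (fun x : Fin p → ℝ => 2 * (x i - θ i) ^ 2 + 2 * θ i ^ 2)
      (gaussVec θ ν) := fun i => ((hcoord i).const_mul 2).add (integrable_const _)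
  calc risk a R lam θ ≤ ∫⁻ ω, ENNReal.ofReal (G (folds ω).2.2) ∂jointLaw lam θ :=
        lintegral_mono hpt
    _ = ∫⁻ x, ENNReal.ofReal (G x) ∂gaussVec θ ν := hmp.lintegral_comp hGm
    _ = ENNReal.ofReal (∫ x, G x ∂gaussVec θ ν) :=
        (ofReal_integral_eq_lintegral_ofReal (integrable_finsetSum _ fun i _ => hterm i)
          (ae_of_all _ fun x => Finset.sum_nonneg fun i _ => by positivity)).symm
    _ = _ := by
        congr 1
        simp only [hG]
        rw [integral_finsetSum _ fun i _ => hterm i]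
        refine Finset.sum_congr rfl fun i _ => ?_
        rw [integral_add ((hcoord i).const_mul 2) (integrable_const _), integral_const_mul,
          integral_eval_gaussVec θ ν i (f := fun x => (x - θ i) ^ 2) (by fun_prop),
          integral_sub_mean_sq_gaussianReal, Real.coe_toNNReal _ hν.le]
        simp

theorem risk_le {p s : ℕ} {a R lam : ℝ} (hsp : s ≤ p) (hlam : 0 < lam) (hR : 0 ≤ R)
    {θ : Fin p → ℝ} (hθ : θ ∈ sparseClass p s R) :
    risk a R lam θ ≤ ENNReal.ofReal (4 * (s * R + p * lam)) := by
  refine (risk_le_sum hlam hR θ).trans (ENNReal.ofReal_le_ofReal ?_)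
  obtain ⟨k, hks, -, -, hθR, h0⟩ := exists_support_of_mem_sparseClass hsp hθ
  have h1 : ∑ i, θ i ^ 2 ≤ s * R := by
    calc ∑ i, θ i ^ 2 ≤ ∑ i : Fin p, if (i : ℕ) < s then R else 0 := by
          refine Finset.sum_le_sum fun i _ => ?_
          split_ifs with h
          · exact hθR i
          · rw [h0 i (by omega)]
            norm_num
      _ = s * R := by
          rw [← Finset.sum_filter, Finset.sum_const, card_filter_val_lt hsp, nsmul_eq_mul]
  rw [Finset.sum_add_distrib, Finset.sum_const, ← Finset.mul_sum, Finset.card_univ,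
    Fintype.card_fin, nsmul_eq_mul]
  have h2 : 0 ≤ (s : ℝ) * R := by positivity
  linarith

/-- The margin condition is so strong relative to the noise that it bounds the dimension: the
polynomial factor `p ^ (-3/2)` is bounded below by a constant depending on `c₀` only. -/
theorem exp_neg_le_rpow_of_margin {c₀ κ ν R p : ℝ} (hc₀ : 0 < c₀) (hκ0 : 0 < κ) (hκ : κ < 1 / 4)
    (hν : 0 < ν) (hR : 0 ≤ R) (hp : 0 < p)
    (h : c₀ * Real.log p ≤ κ ^ 2 * ν / (R + ν)) :
    Real.exp (-(3 / (32 * c₀))) ≤ p ^ (-(3 / 2) : ℝ) := by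
  have h1 : κ ^ 2 * ν / (R + ν) ≤ 1 / 16 := by
    rw [div_le_iff₀ (by positivity)]
    have : κ ^ 2 ≤ 1 / 16 := by nlinarith
    nlinarith
  have h2 : Real.log p ≤ 1 / (16 * c₀) := by
    rw [le_div_iff₀ (by positivity)]
    nlinarith
  rw [Real.rpow_def_of_pos hp]
  refine Real.exp_le_exp.mpr ?_
  have h3 : 3 / (32 * c₀) = 3 / 2 * (1 / (16 * c₀)) := by
    field_simp
    norm_num
  rw [h3]
  linarith

end IsoEB

theorem theorem4p1 :
    -- conditional upper bound
    (∃ C : ℝ, 0 < C ∧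
      ∀ (p s n : ℕ) (σ R a : ℝ), 1 ≤ s → s ≤ p → 1 ≤ n → 0 < σ → 0 < R →
        (a = 1 ∨ a = Real.sqrt 2) →
        (∀ θ ∈ IsoEB.sparseClass p s R,
          IsoEB.jointLaw (σ ^ 2 / n) θ (IsoEB.eventB1 a R (2 * (σ ^ 2 / n)) θ) ≠ 0) ∧
        (σ ^ 2 / n ≤ R →
          (⨆ θ ∈ IsoEB.sparseClass p s R, IsoEB.condRisk a R (σ ^ 2 / n) θ) ≤
            ENNReal.ofReal (C * (s * (σ ^ 2 / n) * Real.log (Real.exp 1 * p / s) *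
              Real.log (1 + R * n / σ ^ 2)))) ∧
        (R ≤ σ ^ 2 / n →
          (⨆ θ ∈ IsoEB.sparseClass p s R, IsoEB.condRisk a R (σ ^ 2 / n) θ) ≤
            ENNReal.ofReal (C * (s * (σ ^ 2 / n) * Real.log (Real.exp 1 * p / s))))) ∧
    -- minimax lower bound
    (∃ c : ℝ, 0 < c ∧
      ∀ (p s n : ℕ) (σ R : ℝ), 1 ≤ s → s ≤ p → 1 ≤ n → 0 < σ → σ ^ 2 / n ≤ R →
        ENNReal.ofReal (c * (s * (σ ^ 2 / n))) ≤ IsoEB.minimaxRisk p s R (σ ^ 2 / n)) ∧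
    -- unconditional upper bound under the margin condition
    (∀ c₀ : ℝ, 0 < c₀ → ∃ C' : ℝ, 0 < C' ∧
      ∀ (p s n : ℕ) (σ R a κ : ℝ), 1 ≤ s → s ≤ p → 1 ≤ n → 0 < σ → 0 < R →
        (a = 1 ∨ a = Real.sqrt 2) → 0 < κ → κ < 1 / 4 →
        c₀ * Real.log p ≤ κ ^ 2 * (2 * (σ ^ 2 / n)) / (R + 2 * (σ ^ 2 / n)) →
        (⨆ θ ∈ {θ ∈ IsoEB.sparseClass p s R | IsoEB.DyadicMargin κ (2 * (σ ^ 2 / n)) θ},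
            IsoEB.risk a R (σ ^ 2 / n) θ) ≤
          ENNReal.ofReal (C' * (s * (σ ^ 2 / n) * Real.log (Real.exp 1 * p / s) *
              Real.log (1 + R * n / σ ^ 2)) +
            C' * (s * R + p * (σ ^ 2 / n)) * (p : ℝ) ^ (-(3 / 2) : ℝ))) := by
  have hfold : ∀ a : ℝ, (a = 1 ∨ a = Real.sqrt 2) → 0 < a ∧ 1 ≤ a ^ 2 ∧ a ^ 2 ≤ 2 := by
    rintro a (rfl | rfl)
    · norm_num
    · rw [Real.sq_sqrt zero_le_two]
      exact ⟨by positivity, by norm_num, le_rfl⟩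
  have hvar : ∀ (n : ℕ) (σ : ℝ), 1 ≤ n → 0 < σ → 0 < σ ^ 2 / n := by
    intro n σ hn hσ
    have : (0 : ℝ) < n := by exact_mod_cast hn
    positivity
  have hlogs : ∀ p s : ℕ, 1 ≤ s → s ≤ p → 1 ≤ Real.log (Real.exp 1 * p / s) := fun p s hs hsp =>
    (IsoEB.one_add_log_le (by exact_mod_cast hs) (by exact_mod_cast hsp)).2
  refine ⟨⟨819200, by norm_num, ?_⟩, ⟨IsoEB.overlap, IsoEB.overlap_pos, ?_⟩, ?_⟩
  · intro p s n σ R a hs hsp hn hσ hR ha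
    obtain ⟨ha0, ha1, ha2⟩ := hfold a ha
    have hlam := hvar n σ hn hσ
    have hL := hlogs p s hs hsp
    have hn0 : (0 : ℝ) < n := by exact_mod_cast hn
    refine ⟨fun θ hθ => ?_, fun hle => iSup₂_le fun θ hθ => ?_, fun hle => iSup₂_le fun θ hθ => ?_⟩
    · obtain ⟨k, -, -, hanti, hθR, -⟩ := IsoEB.exists_support_of_mem_sparseClass hsp hθ
      exact IsoEB.measure_eventB1_ne_zero ha0 hlam hanti hθR
    · refine (IsoEB.condRisk_le hs hsp hlam hR.le ha1 ha2 hθ).trans (ENNReal.ofReal_le_ofReal ?_)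
      have h1 : 1 ≤ R * n / σ ^ 2 := by
        rw [le_div_iff₀ (by positivity), one_mul]
        rwa [div_le_iff₀ hn0] at hle
      have h2 : Real.log 2 ≤ Real.log (1 + R * n / σ ^ 2) :=
        Real.log_le_log (by norm_num) (by linarith)
      have h3 := Real.log_two_gt_d9
      have h4 : 0 ≤ (s : ℝ) * (σ ^ 2 / n) * Real.log (Real.exp 1 * p / s) := by positivity
      nlinarith
    · refine (IsoEB.condRisk_le hs hsp hlam hR.le ha1 ha2 hθ).trans (ENNReal.ofReal_le_ofReal ?_)
      have h4 : 0 ≤ (s : ℝ) * (σ ^ 2 / n) * Real.log (Real.exp 1 * p / s) := by positivity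
      linarith
  · intro p s n σ R hs hsp hn hσ hle
    exact IsoEB.le_minimaxRisk hs hsp (hvar n σ hn hσ) hle
  · intro c₀ hc₀
    refine ⟨4 * Real.exp (3 / (32 * c₀)), by positivity, ?_⟩
    intro p s n σ R a κ hs hsp hn hσ hR ha hκ0 hκ hmargin
    have hlam := hvar n σ hn hσ
    have hp0 : (0 : ℝ) < p := by exact_mod_cast (by omega : 0 < p)
    refine iSup₂_le fun θ hθ => (IsoEB.risk_le hsp hlam hR.le hθ.1).trans
      (ENNReal.ofReal_le_ofReal ?_)
    have hpow := IsoEB.exp_neg_le_rpow_of_margin hc₀ hκ0 hκ (by linarith) hR.le hp0 hmargin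
    have hL := hlogs p s hs hsp
    have h1 : 0 ≤ Real.log (1 + R * n / σ ^ 2) := Real.log_nonneg (by
      have : 0 ≤ R * n / σ ^ 2 := by positivity
      linarith)
    have h2 : 0 ≤ 4 * Real.exp (3 / (32 * c₀)) * (s * (σ ^ 2 / n) *
        Real.log (Real.exp 1 * p / s) * Real.log (1 + R * n / σ ^ 2)) := by
      have h3 : 0 ≤ Real.log (Real.exp 1 * p / s) := by linarith
      positivity
    have h4 : 1 ≤ Real.exp (3 / (32 * c₀)) * (p : ℝ) ^ (-(3 / 2) : ℝ) := by
      rw [Real.exp_neg, inv_le_iff_one_le_mul₀' (Real.exp_pos _)] at hpow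
      exact hpow
    have h5 : 0 ≤ 4 * (s * R + p * (σ ^ 2 / n)) := by positivity
    have h6 := le_mul_of_one_le_right h5 h4
    calc 4 * (s * R + p * (σ ^ 2 / n))
        ≤ 4 * (s * R + p * (σ ^ 2 / n)) *
          (Real.exp (3 / (32 * c₀)) * (p : ℝ) ^ (-(3 / 2) : ℝ)) := h6
      _ = 4 * Real.exp (3 / (32 * c₀)) * (s * R + p * (σ ^ 2 / n)) *
          (p : ℝ) ^ (-(3 / 2) : ℝ) := by ring
      _ ≤ _ := le_add_of_nonneg_left h2
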